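/- **Theorem 2.1.** Let $M$ be a smooth (Hausdorff) manifold of dimension $2n$ with a Riemannian metric $g$ and a smooth $(1,1)$-tensor field $P$ such that $P^2=\mathrm{id}$, $g(Px,Py)=g(x,y)$ and $\operatorname{tr}P=0$. Put $\tilde g(x,y)=g(x,Py)$. Let $\nabla$ be the Levi-Civita connection of $g$, $F(x,y,z)=g((\nabla_xP)y,z)$, $\theta(z)=g^{ij}F(e_i,e_j,z)$, let $\Omega$ be the vector field with $g(\Omega,x)=\theta(x)$, and put $\theta^v(x)=\frac12(\theta(x)-\theta(Px))$, $\theta^h(x)=\frac12(\theta(x)+\theta(Px))$. Suppose that one of the following holds, for all $a,b,\xi,\eta$ with $Pa=a$, $Pb=b$, $P\xi=-\xi$, $P\eta=-\eta$: * $(M,P,g)\in\overline{\mathcal W}_3$, i.e. $F(a,b,\xi)=\frac1n g(a,b)\theta^v(\xi)$ and $F(\xi,\eta,a)=0$; then put $\varepsilon=-1$; * $(M,P,g)\in\overline{\mathcal W}_6$, i.e. $F(\xi,\eta,a)=\frac1n g(\xi,\eta)\theta^h(a)$ and $F(a,b,\xi)=0$; then put $\varepsilon=1$. Suppose that $\theta$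 is closed. Let $\lambda,\mu\in\mathbb R$ and let $\nabla'$ be a natural connection, i.e. a linear connection with $\nabla'g=0$ and $\nabla'P=0$, in the two-parametric family given by the torsion $$\begin{aligned}g(T(x,y),z)={}&\tfrac1{2n}\{g(y,z)\theta(Px)-g(x,z)\theta(Py)\}\\&+\lambda\{g(y,z)\theta(x)-g(x,z)\theta(y)+g(y,Pz)\theta(Px)-g(x,Pz)\theta(Py)\}\\&+\mu\{g(y,Pz)\theta(x)-g(x,Pz)\theta(y)+g(y,z)\theta(Px)-g(x,z)\theta(Py)\}.\end{aligned}$$ Let $R,R'$ be the curvature tensors of $\nabla,\nabla'$, where $R(x,y)z=\nabla_x\nabla_yz-\nabla_y\nabla_xz-\nabla_{[x,y]}z$ and $R(x,y,z,w)=g(R(x,y)z,w)$, and likewise for $R'$. Let $$K(x,y,z,w)=\tfrac12\{R(x,y,z,w)+R(x,y,Pz,Pw)\}.$$ For a $(0,2)$-tensor $S$ let $$\psi_1(S)(x,y,z,w)=g(y,z)S(x,w)-g(x,z)S(y,w)+S(y,z)g(x,w)-S(x,z)g(y,w)$$ and $\psi_2(S)(x,y,z,w)=\psi_1(S)(x,y,Pz,Pw)$.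 Put $p=\lambda\Omega+(\mu+\frac1{2n})P\Omega$, $q=\lambda P\Omega+\mu\Omega$ and $$S(y,z)=\Bigl(\lambda+\varepsilon\mu+\frac{\varepsilon}{4n}\Bigr)(\nabla'_y\theta)z+\frac{g(p,p)+g(q,q)}4\,g(y,z)+\frac{g(p,q)}2\,\tilde g(y,z).$$ Then $S$ is a symmetric $(0,2)$-tensor, $$K=R'-(\psi_1+\psi_2)(S),$$ and $R'$ is a Riemannian $P$-tensor, that is, a $(0,4)$-tensor with $R'(x,y,z,w)=-R'(y,x,z,w)=-R'(x,y,w,z)$, $R'(x,y,z,w)+R'(y,z,x,w)+R'(z,x,y,w)=0$ and $R'(x,y,Pz,Pw)=R'(x,y,z,w)$. -/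

import Mathlib

open Bundle
open scoped Manifold ContDiff

noncomputable section

namespace RAP

/-! ### Linear algebra of an inner product, in a basis -/

section LinearAlgebra

variable {V : Type*} [AddCommGroup V] [Module ℝ V] [FiniteDimensional ℝ V]

/-- The matrix `g_{ij} = g(e_i, e_j)` with respect to a basis `(e_i)` of `V`. -/
def gram (g : V → V → ℝ) :
    Matrix (Fin (Module.finrank ℝ V)) (Fin (Module.finrank ℝ V)) ℝ :=
  fun i j => g (Module.finBasis ℝ V i) (Module.finBasis ℝ V j)

/-- The contraction `g^{ij} B(e_i, e_j)`. -/
def metricTrace (g B : V → V → ℝ) : ℝ :=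
  ∑ i, ∑ j, (gram g)⁻¹ i j * B (Module.finBasis ℝ V i) (Module.finBasis ℝ V j)

/-- The vector `g^{ij} α(e_j) e_i` metrically dual to the covector `α`. -/
def sharp (g : V → V → ℝ) (α : V → ℝ) : V :=
  ∑ i, ∑ j, ((gram g)⁻¹ i j * α (Module.finBasis ℝ V j)) • Module.finBasis ℝ V i

/-- For an inner product `g`, `sharp g α` is the vector with `g(sharp g α, v) = α(v)`. -/
theorem inner_sharp (g : V →ₗ[ℝ] V →ₗ[ℝ] ℝ) (hs : ∀ x y, g x y = g y x)
    (hp : ∀ x, x ≠ 0 → 0 < g x x) (α : V →ₗ[ℝ] ℝ) (v : V) :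
    g (sharp (fun x y => g x y) α) v = α v := by
  have hdet : IsUnit (gram (fun x y => g x y)).det := by
    rw [isUnit_iff_ne_zero]
    intro h0
    obtain ⟨w, hw, hw0⟩ := Matrix.exists_mulVec_eq_zero_iff.2 h0
    have hx : ∑ j, w j • Module.finBasis ℝ V j ≠ 0 := by
      intro h
      apply hw
      funext j
      exact Fintype.linearIndependent_iff.1 (Module.finBasis ℝ V).linearIndependent w h j
    have h1 := hp _ hx
    have h2 : ∀ i, g (Module.finBasis ℝ V i) (∑ j, w j • Module.finBasis ℝ V j) = 0 := by
      intro i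
      have := congrFun hw0 i
      simp only [Matrix.mulVec, dotProduct, gram, Pi.zero_apply] at this
      simpa [map_sum, mul_comm] using this
    have h3 : g (∑ j, w j • Module.finBasis ℝ V j) (∑ j, w j • Module.finBasis ℝ V j) = 0 := by
      rw [map_sum]
      exact Finset.sum_eq_zero fun i _ => by rw [map_smul, hs, h2, smul_zero]
    exact absurd h3 (ne_of_gt h1)
  have key : g (sharp (fun x y => g x y) α) = α := by
    refine (Module.finBasis ℝ V).ext fun k => ?_
    have h : ∀ j, ∑ i, g (Module.finBasis ℝ V k) (Module.finBasis ℝ V i)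
        * (gram (fun x y => g x y))⁻¹ i j = if k = j then 1 else 0 := fun j => by
      have := congrFun (congrFun (Matrix.mul_nonsing_inv _ hdet) k) j
      simpa [Matrix.mul_apply, gram, Matrix.one_apply] using this
    calc g (sharp (fun x y => g x y) α) (Module.finBasis ℝ V k)
        = ∑ j, (∑ i, g (Module.finBasis ℝ V k) (Module.finBasis ℝ V i)
            * (gram (fun x y => g x y))⁻¹ i j) * α (Module.finBasis ℝ V j) := by
          rw [hs, sharp, map_sum, Finset.sum_congr rfl fun i _ => map_sum _ _ _,
            Finset.sum_comm]
          refine Finset.sum_congr rfl fun j _ => ?_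
          rw [Finset.sum_mul]
          refine Finset.sum_congr rfl fun i _ => ?_
          rw [map_smul, smul_eq_mul]
          ring
      _ = α (Module.finBasis ℝ V k) := by simp [h]
  rw [key]

end LinearAlgebra

section Manifold

variable (E : Type*) [NormedAddCommGroup E] [NormedSpace ℝ E]
  (M : Type*) [TopologicalSpace M] [ChartedSpace E M]

/-- The tangent space of `M` at `c`. -/
abbrev T (c : M) : Type _ := TangentSpace 𝓘(ℝ, E) c

/-- Arbitrary (possibly rough) vector fields on `M`. -/
abbrev VF : Type _ := Π c : M, T E M c

variable {E M}

/-- The vector field `X` is smooth, i.e. an element of `𝔛(M)`. -/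
def Smooth [IsManifold 𝓘(ℝ, E) ∞ M] (X : VF E M) : Prop :=
  ContMDiff 𝓘(ℝ, E) (𝓘(ℝ, E).prod 𝓘(ℝ, E)) ∞ (fun c => (⟨c, X c⟩ : TotalSpace E (T E M)))

/-- `X f`, the derivative of the function `f` in the direction of the vector field `X`. -/
def lieD (X : VF E M) (f : M → ℝ) : M → ℝ :=
  fun c => mfderiv 𝓘(ℝ, E) 𝓘(ℝ, ℝ) f c (X c)

variable [FiniteDimensional ℝ E] [IsManifold 𝓘(ℝ, E) ∞ M]

instance (c : M) : FiniteDimensional ℝ (T E M c) := inferInstanceAs (FiniteDimensional ℝ E)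

variable (E M) in
/-- A Riemannian almost product structure `(P, g)` on `M`. -/
structure AlmostProduct where
  /-- the Riemannian metric -/
  g : ContMDiffRiemannianMetric 𝓘(ℝ, E) ∞ E (T E M)
  /-- the almost product structure, a tensor field of type (1,1) -/
  P : Π c : M, T E M c →L[ℝ] T E M c
  smooth_P : ContMDiff 𝓘(ℝ, E) (𝓘(ℝ, E).prod 𝓘(ℝ, E →L[ℝ] E)) ∞
    (fun c => (⟨c, P c⟩ : TotalSpace (E →L[ℝ] E) (fun c => T E M c →L[ℝ] T E M c)))
  P_P (c : M) (x : T E M c) : P c (P c x) = x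
  g_P_P (c : M) (x y : T E M c) : g.inner c (P c x) (P c y) = g.inner c x y

variable (E M) in
/-- Linear connections on `M`; `D Y c u` is `(∇_u Y)(c)`. -/
abbrev Connection : Type _ := CovariantDerivative 𝓘(ℝ, E) E (T E M)

/-- The vector field `∇_X Y`. -/
def nabla (D : Connection E M) (X Y : VF E M) : VF E M := fun c => D Y c (X c)

/-- The curvature operator `R(X,Y)Z = ∇_X ∇_Y Z - ∇_Y ∇_X Z - ∇_{[X,Y]} Z`. -/
def curv (D : Connection E M) (X Y Z : VF E M) : VF E M :=
  nabla D X (nabla D Y Z) - nabla D Y (nabla D X Z)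
    - nabla D (VectorField.mlieBracket 𝓘(ℝ, E) X Y) Z

namespace AlmostProduct

variable (A : AlmostProduct E M)

/-- The function `g(X, Y)`. -/
def gg (X Y : VF E M) : M → ℝ := fun c => A.g.inner c (X c) (Y c)

/-- The vector field `P X`. -/
def PP (X : VF E M) : VF E M := fun c => A.P c (X c)

/-- The tensor `g̃(X, Y) = g(X, P Y)`. -/
def gt (X Y : VF E M) : M → ℝ := A.gg X (A.PP Y)

/-- `tr P = 0`. -/
def TraceFree : Prop :=
  ∀ c, LinearMap.trace ℝ (T E M c) (A.P c : T E M c →ₗ[ℝ] T E M c) = 0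

/-- `∇ g = 0`. -/
def IsMetric (D : Connection E M) : Prop :=
  ∀ X Y Z : VF E M, Smooth X → Smooth Y → Smooth Z →
    lieD X (A.gg Y Z) = A.gg (nabla D X Y) Z + A.gg Y (nabla D X Z)

/-- `D` is the Levi-Civita connection of `g`. -/
def IsLeviCivita (D : Connection E M) : Prop :=
  D.ContMDiffCovariantDerivative ∞ ∧ A.IsMetric D ∧ D.torsion = 0

set_option linter.unusedSectionVars false in
theorem mdifferentiableAt_PP {Y : VF E M} {c : M}
    (hY : MDifferentiableAt 𝓘(ℝ, E) (𝓘(ℝ, E).prod 𝓘(ℝ, E))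
      (fun c => (⟨c, Y c⟩ : TotalSpace E (T E M))) c) :
    MDifferentiableAt 𝓘(ℝ, E) (𝓘(ℝ, E).prod 𝓘(ℝ, E))
      (fun c => (⟨c, A.PP Y c⟩ : TotalSpace E (T E M))) c :=
  MDifferentiableAt.clm_bundle_apply (F₁ := E) (F₂ := E)
    ((A.smooth_P c).mdifferentiableAt (by simp)) hY

theorem tensorial_covP (D : Connection E M) (c : M) :
    TensorialAt 𝓘(ℝ, E) E
      (fun Y : VF E M => D (A.PP Y) c - (A.P c) ∘L (D Y c)) c where
  smul {f Y} hf hY := by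
    have h : A.PP (f • Y) = f • A.PP Y := by
      funext c
      simp [PP]
    rw [h, D.isCovariantDerivativeOnUniv.leibniz (A.mdifferentiableAt_PP hY) hf,
      D.isCovariantDerivativeOnUniv.leibniz hY hf]
    ext u
    simp [PP, smul_sub]
  add {Y Y'} hY hY' := by
    have h : A.PP (Y + Y') = A.PP Y + A.PP Y' := by
      funext c
      simp [PP]
    rw [h, D.isCovariantDerivativeOnUniv.add (A.mdifferentiableAt_PP hY)
      (A.mdifferentiableAt_PP hY'), D.isCovariantDerivativeOnUniv.add hY hY']
    ext u
    simp
    abel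

/-- The tensor `∇ P`: `A.covP D c y x` is `(∇_x P) y = ∇_x (P Y) - P (∇_x Y)` for any extension
`Y` of `y`. -/
def covP (D : Connection E M) (c : M) : T E M c →L[ℝ] T E M c →L[ℝ] T E M c :=
  TensorialAt.mkHom (fun Y : VF E M => D (A.PP Y) c - (A.P c) ∘L (D Y c)) c (A.tensorial_covP D c)

/-- `F(x, y, z) = g((∇_x P) y, z)`, with `D` the Levi-Civita connection. -/
def F (D : Connection E M) {c : M} (x y z : T E M c) : ℝ := A.g.inner c (A.covP D c y x) z

/-- The associated 1-form `θ(z) = g^{ij} F(e_i, e_j, z)`, at a point. -/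
def θ (D : Connection E M) {c : M} (z : T E M c) : ℝ :=
  metricTrace (fun x y => A.g.inner c x y) (fun x y => A.F D x y z)

/-- The function `θ(X)`. -/
def θθ (D : Connection E M) (X : VF E M) : M → ℝ := fun c => A.θ D (X c)

/-- The vector field `Ω`, `g(Ω, x) = θ(x)`. -/
def Ω (D : Connection E M) : VF E M :=
  fun c => sharp (fun x y => A.g.inner c x y) (fun x => A.θ D (c := c) x)

/-- `θ^v(x) = (θ(x) - θ(Px)) / 2`. -/
def θv (D : Connection E M) {c : M} (x : T E M c) : ℝ := (A.θ D x - A.θ D (A.P c x)) / 2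

/-- `θ^h(x) = (θ(x) + θ(Px)) / 2`. -/
def θh (D : Connection E M) {c : M} (x : T E M c) : ℝ := (A.θ D x + A.θ D (A.P c x)) / 2

/-- The Naveira class `W̄₃` (in dimension `2n`). -/
def IsW3 (D : Connection E M) (n : ℕ) : Prop :=
  (∀ (c : M) (a b ξ : T E M c), A.P c a = a → A.P c b = b → A.P c ξ = -ξ →
    A.F D a b ξ = 1 / (n : ℝ) * A.g.inner c a b * A.θv D ξ) ∧
  ∀ (c : M) (ξ η a : T E M c), A.P c ξ = -ξ → A.P c η = -η → A.P c a = a → A.F D ξ η a = 0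

/-- The Naveira class `W̄₆` (in dimension `2n`). -/
def IsW6 (D : Connection E M) (n : ℕ) : Prop :=
  (∀ (c : M) (ξ η a : T E M c), A.P c ξ = -ξ → A.P c η = -η → A.P c a = a →
    A.F D ξ η a = 1 / (n : ℝ) * A.g.inner c ξ η * A.θh D a) ∧
  ∀ (c : M) (a b ξ : T E M c), A.P c a = a → A.P c b = b → A.P c ξ = -ξ → A.F D a b ξ = 0

/-- `dθ = 0`, where `dθ(X,Y) = X θ(Y) - Y θ(X) - θ([X,Y])`. -/
def IsClosedθ (D : Connection E M) : Prop :=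
  ∀ X Y : VF E M, Smooth X → Smooth Y →
    lieD X (A.θθ D Y) - lieD Y (A.θθ D X)
      - A.θθ D (VectorField.mlieBracket 𝓘(ℝ, E) X Y) = 0

/-- A natural connection: a (smooth) linear connection with `∇' g = 0` and `∇' P = 0`. -/
def IsNatural (D' : Connection E M) : Prop :=
  D'.ContMDiffCovariantDerivative ∞ ∧ A.IsMetric D' ∧ A.covP D' = 0

/-- The torsion of `D'` is the member with parameters `lam`, `mu` of the two-parametric family of
torsion tensors built from `g`, `P` and `θ` (`D` is the Levi-Civita connection). -/
def HasTorsion (D D' : Connection E M) (n : ℕ) (lam mu : ℝ) : Prop :=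
  ∀ (c : M) (x y z : T E M c),
    A.g.inner c (D'.torsion c x y) z =
      1 / (2 * n : ℝ) * (A.g.inner c y z * A.θ D (A.P c x) - A.g.inner c x z * A.θ D (A.P c y))
      + lam * (A.g.inner c y z * A.θ D x - A.g.inner c x z * A.θ D y
          + A.g.inner c y (A.P c z) * A.θ D (A.P c x)
          - A.g.inner c x (A.P c z) * A.θ D (A.P c y))
      + mu * (A.g.inner c y (A.P c z) * A.θ D x - A.g.inner c x (A.P c z) * A.θ D y
          + A.g.inner c y z * A.θ D (A.P c x) - A.g.inner c x z * A.θ D (A.P c y))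

/-- The curvature tensor of type (0,4), `R(X,Y,Z,W) = g(R(X,Y)Z, W)`. -/
def R4 (D : Connection E M) (X Y Z W : VF E M) : M → ℝ := A.gg (curv D X Y Z) W

/-- `K(X,Y,Z,W) = (R(X,Y,Z,W) + R(X,Y,PZ,PW)) / 2`. -/
def K (D : Connection E M) (X Y Z W : VF E M) : M → ℝ :=
  fun c => 1 / 2 * (A.R4 D X Y Z W c + A.R4 D X Y (A.PP Z) (A.PP W) c)

/-- The tensor `ψ₁(S)`. -/
def ψ₁ (S : VF E M → VF E M → M → ℝ) (X Y Z W : VF E M) : M → ℝ :=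
  A.gg Y Z * S X W - A.gg X Z * S Y W + S Y Z * A.gg X W - S X Z * A.gg Y W

/-- The tensor `ψ₂(S)`. -/
def ψ₂ (S : VF E M → VF E M → M → ℝ) (X Y Z W : VF E M) : M → ℝ :=
  A.ψ₁ S X Y (A.PP Z) (A.PP W)

/-- The vector field `p = λ Ω + (μ + 1/(2n)) P Ω`. -/
def p (D : Connection E M) (n : ℕ) (lam mu : ℝ) : VF E M :=
  lam • A.Ω D + (mu + 1 / (2 * n : ℝ)) • A.PP (A.Ω D)

/-- The vector field `q = λ P Ω + μ Ω`. -/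
def q (D : Connection E M) (lam mu : ℝ) : VF E M :=
  lam • A.PP (A.Ω D) + mu • A.Ω D

/-- `(∇'_Y θ) Z = Y θ(Z) - θ(∇'_Y Z)`. -/
def covθ (D D' : Connection E M) (Y Z : VF E M) : M → ℝ :=
  lieD Y (A.θθ D Z) - A.θθ D (nabla D' Y Z)

/-- The tensor
`S(Y,Z) = (λ + εμ + ε/(4n)) (∇'_Y θ) Z + (g(p,p) + g(q,q))/4 g(Y,Z) + g(p,q)/2 g̃(Y,Z)`. -/
def S (D D' : Connection E M) (n : ℕ) (lam mu ε : ℝ) (Y Z : VF E M) : M → ℝ :=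
  fun c =>
    (lam + ε * mu + ε / (4 * n : ℝ)) * A.covθ D D' Y Z c
    + (A.gg (A.p D n lam mu) (A.p D n lam mu) c + A.gg (A.q D lam mu) (A.q D lam mu) c) / 4
        * A.gg Y Z c
    + A.gg (A.p D n lam mu) (A.q D lam mu) c / 2 * A.gt Y Z c

end AlmostProduct

/-- A smooth 1-form, i.e. a `C^∞(M)`-linear map from smooth vector fields to smooth functions. -/
structure IsOneForm (φ : VF E M → M → ℝ) : Prop where
  smooth (X : VF E M) : Smooth X → ContMDiff 𝓘(ℝ, E) 𝓘(ℝ, ℝ) ∞ (φ X)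
  add (X X' : VF E M) : Smooth X → Smooth X' → φ (X + X') = φ X + φ X'
  smul (f : M → ℝ) (X : VF E M) :
    ContMDiff 𝓘(ℝ, E) 𝓘(ℝ, ℝ) ∞ f → Smooth X → φ (f • X) = f * φ X

/-- A smooth tensor field of type (0,2). -/
structure IsTensor02 (B : VF E M → VF E M → M → ℝ) : Prop where
  fst (Y : VF E M) : Smooth Y → IsOneForm (fun X => B X Y)
  snd (X : VF E M) : Smooth X → IsOneForm (fun Y => B X Y)

/-- A smooth tensor field of type (0,4). -/
structure IsTensor04 (L : VF E M → VF E M → VF E M → VF E M → M → ℝ) : Prop where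
  fst (Y Z W : VF E M) : Smooth Y → Smooth Z → Smooth W → IsOneForm (fun X => L X Y Z W)
  snd (X Z W : VF E M) : Smooth X → Smooth Z → Smooth W → IsOneForm (fun Y => L X Y Z W)
  trd (X Y W : VF E M) : Smooth X → Smooth Y → Smooth W → IsOneForm (fun Z => L X Y Z W)
  fth (X Y Z : VF E M) : Smooth X → Smooth Y → Smooth Z → IsOneForm (fun W => L X Y Z W)

/-- A curvature-like tensor. -/
structure IsCurvatureLike (L : VF E M → VF E M → VF E M → VF E M → M → ℝ) : Prop where
  tensor : IsTensor04 L
  skew_fst (X Y Z W : VF E M) : Smooth X → Smooth Y → Smooth Z → Smooth W →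
    L X Y Z W = -L Y X Z W
  skew_snd (X Y Z W : VF E M) : Smooth X → Smooth Y → Smooth Z → Smooth W →
    L X Y Z W = -L X Y W Z
  bianchi (X Y Z W : VF E M) : Smooth X → Smooth Y → Smooth Z → Smooth W →
    L X Y Z W + L Y Z X W + L Z X Y W = 0

/-- A Riemannian `P`-tensor. -/
structure AlmostProduct.IsPTensor (A : AlmostProduct E M)
    (L : VF E M → VF E M → VF E M → VF E M → M → ℝ) : Prop where
  curvatureLike : IsCurvatureLike L
  invariant (X Y Z W : VF E M) : Smooth X → Smooth Y → Smooth Z → Smooth W →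
    L X Y (A.PP Z) (A.PP W) = L X Y Z W

end Manifold

end RAP

end

/-!
Let `a = λ + εμ + ε/(2n)` and `b = ελ + μ`, let `L = a + bP`, and let `∇'θ` be the form
`(y, z) ↦ g(∇'_y Ω, z)`.

The two classes are treated at once (`IsWε`): `P` acts as `ε` on one of its eigenbundles, and
`F(x, y, ξ) = (1/n) g(x, y) θ(ξ)` for `x`, `y` in the other one and `ξ` in the former. The trace
that defines `θ` then vanishes on the `-ε`-eigenbundle (`IsWε.θ_eq_zero`), so that `θ ∘ P = εθ` and
`PΩ = εΩ`. Since `(∇_x P) x = (1/n) g(x, x) Ω` for `x` in the `-ε`-eigenbundle, which is not zero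
because `tr P = 0`, the field `Ω` is smooth (`IsWε.smooth_Ω`).

With `PΩ = εΩ` the torsion becomes `T(x, y) = θ(x) Ly - θ(y) Lx`, and the Koszul argument gives
`∇ = ∇' - Q` with `Q_x z = g(Lx, z) Ω - θ(z) Lx` (`HasVectorialTorsion.nabla_eq`). As `g` and `P`
are `∇'`-parallel, only `Ω` contributes to `∇'Q`, and
`R(x, y)z = R'(x, y)z - (∇'_x Q)_y z + (∇'_y Q)_x z - Q_{T(x, y)} z + [Q_x, Q_y] z`
(`HasVectorialTorsion.curv_eq`). Closedness of `θ` says that `∇'θ` is symmetric, because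
`θ(T(x, y)) = 0`. Averaging the last formula over `P` in the arguments `z` and `w` and using
`(a + bP)(1 + εP) = (a + εb)(1 + εP)` gives the formula for `K` (`curvDiff_average`): the
coefficient of `∇'θ` in `S` is `(a + εb)/2`, and `p = aΩ`, `q = bΩ`.

`R'` is skew in the last two arguments because `∇'` is metric (`IsMetric.gg_curv`) and is invariant
under `P` because `P` is parallel. The first Bianchi identity for `R'` follows from that for `R`,
since the cyclic sum of the difference vanishes when `∇'θ` is symmetric (`curvDiff_cyclic`).
-/

set_option linter.unusedSectionVars false

noncomputable section

namespace RAP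

variable {E : Type*} [NormedAddCommGroup E] [NormedSpace ℝ E] [FiniteDimensional ℝ E]
  {M : Type*} [TopologicalSpace M] [ChartedSpace E M] [IsManifold 𝓘(ℝ, E) ∞ M]

/-! ### Smooth vector fields and connections -/

namespace Smooth

theorem add {X Y : VF E M} (hX : Smooth X) (hY : Smooth Y) : Smooth (X + Y) :=
  ContMDiff.add_section hX hY

theorem sub {X Y : VF E M} (hX : Smooth X) (hY : Smooth Y) : Smooth (X - Y) :=
  ContMDiff.sub_section hX hY

theorem const_smul {X : VF E M} (a : ℝ) (hX : Smooth X) : Smooth (a • X) :=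
  ContMDiff.const_smul_section hX

theorem smul {f : M → ℝ} {X : VF E M} (hf : ContMDiff 𝓘(ℝ, E) 𝓘(ℝ, ℝ) ∞ f) (hX : Smooth X) :
    Smooth (f • X) :=
  ContMDiff.smul_section hf hX

theorem mdifferentiableAt {X : VF E M} (hX : Smooth X) (c : M) :
    MDifferentiableAt 𝓘(ℝ, E) (𝓘(ℝ, E).prod 𝓘(ℝ, E))
      (fun c => (⟨c, X c⟩ : TotalSpace E (T E M))) c :=
  (hX c).mdifferentiableAt (by simp)

theorem minSmoothness {X : VF E M} (hX : Smooth X) :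
    ContMDiff 𝓘(ℝ, E) (𝓘(ℝ, E).prod 𝓘(ℝ, E)) (minSmoothness ℝ 2)
      (fun c => (⟨c, X c⟩ : TotalSpace E (T E M))) :=
  ContMDiff.of_le hX (by rw [minSmoothness_of_isRCLikeNormedField]; exact ENat.LEInfty.out)

theorem bracket {X Y : VF E M} (hX : Smooth X) (hY : Smooth Y) :
    Smooth (VectorField.mlieBracket 𝓘(ℝ, E) X Y) := by
  have : IsManifold 𝓘(ℝ, E) (_root_.minSmoothness ℝ 2) M :=
    IsManifold.of_le (n := ∞) (by rw [minSmoothness_of_isRCLikeNormedField]; exact ENat.LEInfty.out)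
  have : IsManifold 𝓘(ℝ, E) (((⊤ : ℕ∞) : ℕ∞ω) + 1) M :=
    IsManifold.of_le (n := ∞) (by simp)
  exact ContDiff.mlieBracket_vectorField (m := ⊤) (n := ⊤) hX hY (by simp)

theorem PP (A : AlmostProduct E M) {X : VF E M} (hX : Smooth X) : Smooth (A.PP X) :=
  ContMDiff.clm_bundle_apply (F₁ := E) (F₂ := E) A.smooth_P hX

theorem gg (A : AlmostProduct E M) {X Y : VF E M} (hX : Smooth X) (hY : Smooth Y) :
    ContMDiff 𝓘(ℝ, E) 𝓘(ℝ, ℝ) ∞ (A.gg X Y) := by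
  let e : RiemannianBundle (T E M) := ⟨A.g.toRiemannianMetric⟩
  exact ContMDiff.inner_bundle (F := E) (E := T E M) hX hY

theorem nabla {D : Connection E M} (hD : D.ContMDiffCovariantDerivative ∞) {X Y : VF E M}
    (hX : Smooth X) (hY : Smooth Y) : Smooth (nabla D X Y) := by
  have h := hD.contMDiff.contMDiff (σ := Y) (contMDiffOn_univ.2 hY)
  exact ContMDiff.clm_bundle_apply (F₁ := E) (F₂ := E) (contMDiffOn_univ.1 h) hX

theorem curv {D : Connection E M} (hD : D.ContMDiffCovariantDerivative ∞) {X Y Z : VF E M}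
    (hX : Smooth X) (hY : Smooth Y) (hZ : Smooth Z) : Smooth (curv D X Y Z) :=
  ((hX.nabla hD (hY.nabla hD hZ)).sub (hY.nabla hD (hX.nabla hD hZ))).sub
    ((hX.bracket hY).nabla hD hZ)

/-- Every tangent vector is the value of a globally smooth vector field. -/
theorem exists_eq [T2Space M] {c : M} (v : T E M c) : ∃ X : VF E M, Smooth X ∧ X c = v := by
  obtain ⟨s, hs, hv⟩ := FiberBundle.exists_contMDiffOn_extend (k := ∞) 𝓘(ℝ, E) E
    (V := T E M) v
  obtain ⟨u, hus, hu, hcu⟩ := mem_nhds_iff.1 hs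
  obtain ⟨f, -, hf⟩ := (SmoothBumpFunction.nhds_basis_tsupport (I := 𝓘(ℝ, E)) c).mem_iff.1
    (hu.mem_nhds hcu)
  refine ⟨(f : M → ℝ) • FiberBundle.extend E v, ?_, ?_⟩
  · exact ContMDiffOn.smul_section_of_tsupport f.contMDiff.contMDiffOn hu hf (hv.mono hus)
  · change f c • FiberBundle.extend E v c = v
    simp

end Smooth

theorem lieD_add {f h : M → ℝ} (hf : ContMDiff 𝓘(ℝ, E) 𝓘(ℝ, ℝ) ∞ f)
    (hh : ContMDiff 𝓘(ℝ, E) 𝓘(ℝ, ℝ) ∞ h) (X : VF E M) :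
    lieD X (f + h) = lieD X f + lieD X h := by
  funext c
  have := mfderiv_add ((hf c).mdifferentiableAt (by simp)) ((hh c).mdifferentiableAt (by simp))
  simp only [lieD, Pi.add_apply]
  rw [this]
  rfl

section Connection

variable (D : Connection E M)

theorem nabla_add {Y Y' : VF E M} (hY : Smooth Y) (hY' : Smooth Y') (X : VF E M) :
    nabla D X (Y + Y') = nabla D X Y + nabla D X Y' := by
  funext c
  have := D.isCovariantDerivativeOnUniv.add (hY.mdifferentiableAt c) (hY'.mdifferentiableAt c)
  exact congrArg (fun L => L (X c)) this

theorem nabla_const_smul {Y : VF E M} (hY : Smooth Y) (a : ℝ) (X : VF E M) :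
    nabla D X (a • Y) = a • nabla D X Y := by
  funext c
  have := D.isCovariantDerivativeOnUniv.smul_const a (hY.mdifferentiableAt c)
  exact congrArg (fun L => L (X c)) this

theorem nabla_sub {Y Y' : VF E M} (hY : Smooth Y) (hY' : Smooth Y') (X : VF E M) :
    nabla D X (Y - Y') = nabla D X Y - nabla D X Y' := by
  have h : Y - Y' = Y + (-1 : ℝ) • Y' := by simp [sub_eq_add_neg]
  rw [h, nabla_add D hY (hY'.const_smul _), nabla_const_smul D hY']
  simp [sub_eq_add_neg]

theorem nabla_smul {f : M → ℝ} {Y : VF E M} (hf : ContMDiff 𝓘(ℝ, E) 𝓘(ℝ, ℝ) ∞ f)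
    (hY : Smooth Y) (X : VF E M) :
    nabla D X (f • Y) = f • nabla D X Y + lieD X f • Y := by
  funext c
  have := D.isCovariantDerivativeOnUniv.leibniz (hY.mdifferentiableAt c)
    ((hf c).mdifferentiableAt (by simp))
  exact congrArg (fun L => L (X c)) this

theorem nabla_add_left (X X' Y : VF E M) : nabla D (X + X') Y = nabla D X Y + nabla D X' Y := by
  funext c
  simp [nabla]

theorem nabla_smul_left (f : M → ℝ) (X Y : VF E M) : nabla D (f • X) Y = f • nabla D X Y := by
  funext c
  simp [nabla]

theorem nabla_sub_left (X X' Y : VF E M) : nabla D (X - X') Y = nabla D X Y - nabla D X' Y := by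
  funext c
  simp [nabla]

theorem torsion_apply {X Y : VF E M} (hX : Smooth X) (hY : Smooth Y) (c : M) :
    D.torsion c (X c) (Y c)
      = nabla D X Y c - nabla D Y X c - VectorField.mlieBracket 𝓘(ℝ, E) X Y c :=
  CovariantDerivative.torsion_apply D (hX.mdifferentiableAt c) (hY.mdifferentiableAt c)

end Connection

theorem mlieBracket_smul_right {f : M → ℝ} {Y : VF E M}
    (hf : ContMDiff 𝓘(ℝ, E) 𝓘(ℝ, ℝ) ∞ f) (hY : Smooth Y) (X : VF E M) :
    VectorField.mlieBracket 𝓘(ℝ, E) X (f • Y)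
      = lieD X f • Y + f • VectorField.mlieBracket 𝓘(ℝ, E) X Y := by
  funext c
  exact VectorField.mlieBracket_smul_right ((hf c).mdifferentiableAt (by simp))
    (hY.mdifferentiableAt c)

theorem mlieBracket_smul_left {f : M → ℝ} {X : VF E M}
    (hf : ContMDiff 𝓘(ℝ, E) 𝓘(ℝ, ℝ) ∞ f) (hX : Smooth X) (Y : VF E M) :
    VectorField.mlieBracket 𝓘(ℝ, E) (f • X) Y
      = f • VectorField.mlieBracket 𝓘(ℝ, E) X Y - lieD Y f • X := by
  rw [VectorField.mlieBracket_swap, mlieBracket_smul_right hf hX,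
    VectorField.mlieBracket_swap (V := Y)]
  funext c
  simp [sub_eq_add_neg, add_comm]

theorem mlieBracket_add_right {Y Y' : VF E M} (hY : Smooth Y) (hY' : Smooth Y') (X : VF E M) :
    VectorField.mlieBracket 𝓘(ℝ, E) X (Y + Y')
      = VectorField.mlieBracket 𝓘(ℝ, E) X Y + VectorField.mlieBracket 𝓘(ℝ, E) X Y' := by
  funext c
  exact VectorField.mlieBracket_add_right (hY.mdifferentiableAt c) (hY'.mdifferentiableAt c)

theorem mlieBracket_add_left {X X' : VF E M} (hX : Smooth X) (hX' : Smooth X') (Y : VF E M) :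
    VectorField.mlieBracket 𝓘(ℝ, E) (X + X') Y
      = VectorField.mlieBracket 𝓘(ℝ, E) X Y + VectorField.mlieBracket 𝓘(ℝ, E) X' Y := by
  funext c
  exact VectorField.mlieBracket_add_left (hX.mdifferentiableAt c) (hX'.mdifferentiableAt c)

theorem jacobi {X Y Z : VF E M} (hX : Smooth X) (hY : Smooth Y) (hZ : Smooth Z) :
    VectorField.mlieBracket 𝓘(ℝ, E) X (VectorField.mlieBracket 𝓘(ℝ, E) Y Z)
      = VectorField.mlieBracket 𝓘(ℝ, E) (VectorField.mlieBracket 𝓘(ℝ, E) X Y) Z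
        + VectorField.mlieBracket 𝓘(ℝ, E) Y (VectorField.mlieBracket 𝓘(ℝ, E) X Z) := by
  have : IsManifold 𝓘(ℝ, E) (minSmoothness ℝ 3) M :=
    IsManifold.of_le (n := ∞) (by rw [minSmoothness_of_isRCLikeNormedField]; exact ENat.LEInfty.out)
  exact VectorField.leibniz_identity_mlieBracket hX.minSmoothness hY.minSmoothness
    hZ.minSmoothness

/-- A bracket acts on functions as the commutator of derivations. It is read off from the
Jacobi identity for `X`, `Y` and `f • Z`, where `Z` is a field that does not vanish at the point. -/
theorem lieD_mlieBracket [T2Space M] {X Y : VF E M} (hX : Smooth X) (hY : Smooth Y) {f : M → ℝ}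
    (hf : ContMDiff 𝓘(ℝ, E) 𝓘(ℝ, ℝ) ∞ f)
    (hXf : ContMDiff 𝓘(ℝ, E) 𝓘(ℝ, ℝ) ∞ (lieD X f))
    (hYf : ContMDiff 𝓘(ℝ, E) 𝓘(ℝ, ℝ) ∞ (lieD Y f)) :
    lieD (VectorField.mlieBracket 𝓘(ℝ, E) X Y) f
      = lieD X (lieD Y f) - lieD Y (lieD X f) := by
  funext c
  by_cases hc : ∃ v : T E M c, v ≠ 0
  · obtain ⟨v, hv⟩ := hc
    obtain ⟨Z, hZ, rfl⟩ := Smooth.exists_eq v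
    have h := congrFun (jacobi hX hY (hZ.smul hf)) c
    have h₀ := congrFun (jacobi hX hY hZ) c
    rw [mlieBracket_smul_right hf hZ, mlieBracket_smul_right hf hZ,
      mlieBracket_smul_right hf hZ,
      mlieBracket_add_right (hZ.smul hYf) ((hY.bracket hZ).smul hf),
      mlieBracket_add_right (hZ.smul hXf) ((hX.bracket hZ).smul hf),
      mlieBracket_smul_right hf (hY.bracket hZ), mlieBracket_smul_right hf (hX.bracket hZ),
      mlieBracket_smul_right hYf hZ, mlieBracket_smul_right hXf hZ] at h
    simp only [Pi.add_apply, Pi.smul_apply'] at h h₀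
    rw [h₀] at h
    have h' : (lieD (VectorField.mlieBracket 𝓘(ℝ, E) X Y) f c
        - (lieD X (lieD Y f) c - lieD Y (lieD X f) c)) • Z c = 0 := by
      rw [← sub_eq_zero] at h
      rw [← neg_eq_zero, ← h]
      module
    rcases smul_eq_zero.1 h' with h' | h'
    · exact sub_eq_zero.1 h'
    · exact absurd h' hv
  · have h0 : ∀ v : T E M c, v = 0 := by simpa using hc
    have key (X : VF E M) (f : M → ℝ) : lieD X f c = 0 := by
      simp only [lieD]
      rw [h0 (X c)]
      exact map_zero _
    simp [key]

/-! ### The structure tensor and the Lee form -/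

namespace AlmostProduct

variable (A : AlmostProduct E M)

theorem inner_P_left {c : M} (x y : T E M c) :
    A.g.inner c (A.P c x) y = A.g.inner c x (A.P c y) := by
  rw [← A.g_P_P c x (A.P c y), A.P_P]

theorem eq_of_inner_eq {c : M} {x y : T E M c}
    (h : ∀ z, A.g.inner c x z = A.g.inner c y z) : x = y := by
  by_contra hne
  have := A.g.pos c (x - y) (sub_ne_zero.2 hne)
  rw [map_sub (A.g.inner c), sub_apply, h, sub_self] at this
  exact lt_irrefl _ this

theorem PP_PP (X : VF E M) : A.PP (A.PP X) = X := by
  funext c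
  exact A.P_P c _

theorem gg_comm (X Y : VF E M) : A.gg X Y = A.gg Y X := by
  funext c
  exact A.g.symm c _ _

theorem gg_PP_left (X Y : VF E M) : A.gg (A.PP X) Y = A.gg X (A.PP Y) := by
  funext c
  exact A.inner_P_left _ _

theorem covP_apply (D : Connection E M) {Y : VF E M} (hY : Smooth Y) (c : M) (u : T E M c) :
    A.covP D c (Y c) u = D (A.PP Y) c u - A.P c (D Y c u) := by
  rw [covP, TensorialAt.mkHom_apply _ (hY.mdifferentiableAt c)]
  rfl

/-- `∇P` anticommutes with `P`, since `P² = 1` is parallel. -/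
theorem covP_P [T2Space M] (D : Connection E M) {c : M} (y u : T E M c) :
    A.covP D c (A.P c y) u = -A.P c (A.covP D c y u) := by
  obtain ⟨Y, hY, rfl⟩ := Smooth.exists_eq y
  have h := A.covP_apply D (hY.PP A) c u
  rw [A.PP_PP] at h
  rw [A.covP_apply D hY, map_sub, A.P_P]
  change A.covP D c (A.PP Y c) u = _
  rw [h]
  abel

theorem F_P [T2Space M] (D : Connection E M) {c : M} (x y z : T E M c) :
    A.F D x (A.P c y) z = -A.F D x y (A.P c z) := by
  simp only [F]
  rw [A.covP_P, map_neg, neg_apply, A.inner_P_left]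

theorem F_symm [T2Space M] {D : Connection E M} (hD : A.IsMetric D) {c : M} (x y z : T E M c) :
    A.F D x y z = A.F D x z y := by
  obtain ⟨X, hX, rfl⟩ := Smooth.exists_eq x
  obtain ⟨Y, hY, rfl⟩ := Smooth.exists_eq y
  obtain ⟨Z, hZ, rfl⟩ := Smooth.exists_eq z
  have h₁ := congrFun (hD X (A.PP Y) Z hX (hY.PP A) hZ) c
  have h₂ := congrFun (hD X Y (A.PP Z) hX hY (hZ.PP A)) c
  rw [A.gg_PP_left, h₂] at h₁
  simp only [F, A.covP_apply D hY, A.covP_apply D hZ]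
  simp only [Pi.add_apply, gg, PP, nabla] at h₁
  simp only [map_sub, sub_apply, A.inner_P_left]
  rw [A.g.symm c (D (A.PP Z) c (X c)) (Y c), A.g.symm c (D Z c (X c)) (A.P c (Y c)),
    A.inner_P_left]
  simp only [A.inner_P_left] at h₁ ⊢
  linarith

/-- `F(x, y, z)` vanishes when `y` and `z` are in the same eigenspace of `P`, since `∇P`
anticommutes with `P`. -/
theorem F_eq_zero [T2Space M] {D : Connection E M} {s : ℝ} (hs : s ≠ 0) {c : M} {x y z : T E M c}
    (hy : A.P c y = s • y) (hz : A.P c z = s • z) : A.F D x y z = 0 := by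
  have h := A.F_P D x y z
  rw [hy, hz] at h
  simp only [F, map_smul, smul_apply, smul_eq_mul] at h ⊢
  have h' : s * A.g.inner c (A.covP D c y x) z = 0 := by linarith
  exact (mul_eq_zero.1 h').resolve_left hs

/-- The metric at a point, as a bilinear form. -/
def innerₗ (c : M) : T E M c →ₗ[ℝ] T E M c →ₗ[ℝ] ℝ :=
  LinearMap.mk₂ ℝ (fun x y => A.g.inner c x y) (by simp) (by simp) (by simp) (by simp)

/-- The Lee form `θ` at a point, as a linear form. -/
def θₗ (D : Connection E M) (c : M) : T E M c →ₗ[ℝ] ℝ where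
  toFun z := A.θ D z
  map_add' x y := by
    simp only [θ, metricTrace, F, map_add, mul_add, Finset.sum_add_distrib]
  map_smul' a x := by
    simp only [θ, metricTrace, F, map_smul, Finset.mul_sum, smul_eq_mul, RingHom.id_apply]
    exact Finset.sum_congr rfl fun i _ => Finset.sum_congr rfl fun j _ => by ring

theorem inner_sharp_apply {c : M} (α : T E M c →ₗ[ℝ] ℝ) (x : T E M c) :
    A.g.inner c (sharp (fun x y => A.g.inner c x y) α) x = α x :=
  inner_sharp (A.innerₗ c) (A.g.symm c) (A.g.pos c) α x

theorem inner_Ω (D : Connection E M) {c : M} (x : T E M c) :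
    A.g.inner c (A.Ω D c) x = A.θ D x :=
  A.inner_sharp_apply (A.θₗ D c) x

/-- The trace of a rank one bilinear form `g(·, v) ⊗ α` is `α(v)`. -/
theorem metricTrace_inner_mul {c : M} (α : T E M c →ₗ[ℝ] ℝ) (v : T E M c) :
    metricTrace (fun x y => A.g.inner c x y) (fun x y => A.g.inner c x v * α y) = α v := by
  rw [← A.inner_sharp_apply α v, sharp, map_sum, sum_apply, metricTrace]
  refine Finset.sum_congr rfl fun i _ => ?_
  rw [map_sum, sum_apply]
  refine Finset.sum_congr rfl fun j _ => ?_
  rw [map_smul, smul_apply, smul_eq_mul]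
  ring

/-- The common form of the conditions defining the two classes: `ε = -1` gives `W̄₃` and `ε = 1`
gives `W̄₆`, with `P` acting as `-ε` on `a`, `b` and as `ε` on `ξ`, `η`. On the `ε`-eigenspace
the relevant projection of `θ` is `θ` itself. -/
structure IsWε (D : Connection E M) (n : ℕ) (ε : ℝ) : Prop where
  sq : ε * ε = 1
  main (c : M) (a b ξ : T E M c) : A.P c a = -(ε • a) → A.P c b = -(ε • b) → A.P c ξ = ε • ξ →
    A.F D a b ξ = 1 / (n : ℝ) * A.g.inner c a b * A.θ D ξ
  vanish (c : M) (ξ η a : T E M c) : A.P c ξ = ε • ξ → A.P c η = ε • η → A.P c a = -(ε • a) →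
    A.F D ξ η a = 0

theorem isWε_of {D : Connection E M} {n : ℕ} {ε : ℝ}
    (h : (A.IsW3 D n ∧ ε = -1) ∨ (A.IsW6 D n ∧ ε = 1)) : A.IsWε D n ε := by
  have hneg (c : M) (x : T E M c) : A.θ D (-x) = -A.θ D x := map_neg (A.θₗ D c) x
  rcases h with ⟨⟨h₁, h₂⟩, rfl⟩ | ⟨⟨h₁, h₂⟩, rfl⟩
  · refine ⟨by norm_num, fun c a b ξ ha hb hξ => ?_, fun c ξ η a hξ hη ha => ?_⟩
    · rw [neg_one_smul] at hξ
      rw [neg_one_smul, neg_neg] at ha hb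
      rw [h₁ c a b ξ ha hb hξ, θv, hξ, hneg]
      ring
    · rw [neg_one_smul] at hξ hη
      rw [neg_one_smul, neg_neg] at ha
      exact h₂ c ξ η a hξ hη ha
  · refine ⟨by norm_num, fun c a b ξ ha hb hξ => ?_, fun c ξ η a hξ hη ha => ?_⟩
    · rw [one_smul] at hξ ha hb
      rw [h₁ c a b ξ ha hb hξ, θh, hξ]
      ring
    · rw [one_smul] at hξ hη ha
      exact h₂ c ξ η a hξ hη ha

namespace IsWε

variable {A} {D : Connection E M} {n : ℕ} {ε : ℝ}

/-- The vector `x + εPx` is in the `ε`-eigenspace of `P`. -/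
theorem P_add (h : A.IsWε D n ε) {c : M} (x : T E M c) :
    A.P c (x + ε • A.P c x) = ε • (x + ε • A.P c x) := by
  rw [map_add, map_smul, A.P_P, smul_add, smul_smul, h.sq, one_smul, add_comm]

/-- The vector `x - εPx` is in the `-ε`-eigenspace of `P`. -/
theorem P_sub (h : A.IsWε D n ε) {c : M} (x : T E M c) :
    A.P c (x - ε • A.P c x) = -(ε • (x - ε • A.P c x)) := by
  rw [map_sub, map_smul, A.P_P, smul_sub, smul_smul, h.sq, one_smul, neg_sub]

/-- The form `θ` vanishes on the `-ε`-eigenspace: for `a` in it, `F(x, y, a)` is a multiple of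
`g(x, a) θ(y + εPy)`, whose trace is `θ(a + εPa) = 0`. -/
theorem θ_eq_zero [T2Space M] (h : A.IsWε D n ε) (hD : A.IsMetric D) {c : M} {a : T E M c}
    (ha : A.P c a = -(ε • a)) : A.θ D a = 0 := by
  have hε : ε ≠ 0 := fun h0 => by simpa [h0] using h.sq
  have hF (x y : T E M c) : A.F D x y a
      = 1 / (n : ℝ) * (A.g.inner c x a * (1 / 2 * A.θ D (y + ε • A.P c y))) := by
    have h₁ := h.main c (x - ε • A.P c x) a (y + ε • A.P c y) (h.P_sub x) ha (h.P_add y)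
    have h₂ := h.vanish c (x + ε • A.P c x) (y + ε • A.P c y) a (h.P_add x) (h.P_add y) ha
    have h₃ : A.F D x (y - ε • A.P c y) a = 0 :=
      A.F_eq_zero (s := -ε) (neg_ne_zero.2 hε) (by rw [h.P_sub, neg_smul]) (by rw [ha, neg_smul])
    rw [A.F_symm hD] at h₁
    have h₄ : A.g.inner c (A.P c x) a = -(ε * A.g.inner c x a) := by
      rw [A.inner_P_left, ha, map_neg, map_smul, smul_eq_mul]
    simp only [F, map_add, map_sub, map_smul, add_apply,
      sub_apply, smul_apply, smul_eq_mul] at h₁ h₂ h₃ ⊢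
    rw [h₄] at h₁
    linear_combination (1 / 4) * h₁ + (1 / 4) * h₂ + (1 / 2) * h₃
      + 1 / 4 * (1 / (n : ℝ)) * A.g.inner c x a * A.θ D (y + ε • A.P c y) * h.sq
  have htr := A.metricTrace_inner_mul
    ((1 / 2 : ℝ) • (A.θₗ D c ∘ₗ (LinearMap.id + ε • (A.P c : T E M c →ₗ[ℝ] T E M c)))) a
  have h0 : a + ε • A.P c a = 0 := by
    rw [ha, smul_neg, smul_smul, h.sq, one_smul, add_neg_cancel]
  have hr : ((1 / 2 : ℝ) • (A.θₗ D c ∘ₗ (LinearMap.id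
      + ε • (A.P c : T E M c →ₗ[ℝ] T E M c)))) a = 0 := by
    change (1 / 2 : ℝ) • A.θₗ D c (a + ε • A.P c a) = 0
    rw [h0, map_zero, smul_zero]
  rw [hr] at htr
  have : A.θ D a = 1 / (n : ℝ) * metricTrace (fun x y => A.g.inner c x y)
      (fun x y => A.g.inner c x a * (1 / 2 * A.θ D (y + ε • A.P c y))) := by
    change metricTrace (fun x y => A.g.inner c x y) (fun x y => A.F D x y a) = _
    simp only [hF, metricTrace, Finset.mul_sum]
    exact Finset.sum_congr rfl fun i _ => Finset.sum_congr rfl fun j _ => by ring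
  rw [this]
  exact mul_eq_zero_of_right _ htr

theorem θ_P [T2Space M] (h : A.IsWε D n ε) (hD : A.IsMetric D) {c : M} (x : T E M c) :
    A.θ D (A.P c x) = ε * A.θ D x := by
  have h₁ : A.θₗ D c (x - ε • A.P c x) = 0 := h.θ_eq_zero hD (h.P_sub x)
  rw [map_sub, map_smul, smul_eq_mul] at h₁
  change A.θₗ D c (A.P c x) = ε * A.θₗ D c x
  linear_combination -ε * h₁ - A.θₗ D c (A.P c x) * h.sq

theorem P_Ω [T2Space M] (h : A.IsWε D n ε) (hD : A.IsMetric D) (c : M) :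
    A.P c (A.Ω D c) = ε • A.Ω D c := by
  refine A.eq_of_inner_eq fun z => ?_
  rw [A.inner_P_left, A.inner_Ω, h.θ_P hD, map_smul, smul_apply, A.inner_Ω,
    smul_eq_mul]

/-- In the `-ε`-eigenspace, `(∇_x P) x = (1/n) g(x, x) Ω`. -/
theorem covP_self [T2Space M] (h : A.IsWε D n ε) (hD : A.IsMetric D) {c : M} {x : T E M c}
    (hx : A.P c x = -(ε • x)) :
    A.covP D c x x = (1 / (n : ℝ) * A.g.inner c x x) • A.Ω D c := by
  have hε : ε ≠ 0 := fun h0 => by simpa [h0] using h.sq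
  refine A.eq_of_inner_eq fun z => ?_
  have h₁ := h.main c x x (z + ε • A.P c z) hx hx (h.P_add z)
  have h₂ : A.F D x x (z - ε • A.P c z) = 0 :=
    A.F_eq_zero (s := -ε) (neg_ne_zero.2 hε) (by rw [hx, neg_smul]) (by rw [h.P_sub, neg_smul])
  have h₃ : A.θ D (z + ε • A.P c z) = 2 * A.θ D z := by
    change A.θₗ D c (z + ε • A.P c z) = 2 * A.θₗ D c z
    have h₄ : A.θₗ D c (A.P c z) = ε * A.θₗ D c z := h.θ_P hD z
    rw [map_add, map_smul, h₄, smul_eq_mul, ← mul_assoc, h.sq]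
    ring
  rw [h₃] at h₁
  rw [map_smul, smul_apply, A.inner_Ω, smul_eq_mul]
  simp only [F, map_add, map_sub] at h₁ h₂
  linear_combination (1 / 2) * h₁ + (1 / 2) * h₂

/-- The `-ε`-eigenspace is nonzero, because `P` is trace free. -/
theorem exists_ne_zero (h : A.IsWε D n ε) (hdim : Module.finrank ℝ E = 2 * n) (hn : n ≠ 0)
    (htr : A.TraceFree) (c : M) : ∃ x : T E M c, x ≠ 0 ∧ A.P c x = -(ε • x) := by
  have hε : ε ≠ 0 := fun h0 => by simpa [h0] using h.sq
  by_contra! hcon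
  have hP : (A.P c : T E M c →ₗ[ℝ] T E M c) = ε • LinearMap.id := by
    ext y
    have hy : y - ε • A.P c y = 0 := by
      by_contra hne
      exact hcon _ hne (h.P_sub y)
    have := congrArg (ε • ·) hy
    simp only [smul_sub, smul_smul, h.sq, one_smul, smul_zero] at this
    exact (sub_eq_zero.1 this).symm
  have h₁ := htr c
  rw [hP, map_smul, LinearMap.trace_id] at h₁
  have h₂ : Module.finrank ℝ (T E M c) = 2 * n := hdim
  rw [h₂] at h₁
  simp [hε, hn] at h₁

/-- `Ω` is smooth: near each point it is `n / g(X, X)` times `(∇_X P) X`, for a smooth field `X`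
in the `-ε`-eigenspace that does not vanish at the point. -/
theorem smooth_Ω [T2Space M] (h : A.IsWε D n ε) (hdim : Module.finrank ℝ E = 2 * n)
    (htr : A.TraceFree) (hD : A.IsMetric D) (hD' : D.ContMDiffCovariantDerivative ∞) :
    Smooth (A.Ω D) := by
  -- In dimension zero all tangent vectors vanish, and so does `Ω`.
  rcases eq_or_ne n 0 with rfl | hn
  · have : Subsingleton E := Module.finrank_zero_iff.1 (by simpa using hdim)
    have h0 : A.Ω D = (0 : ℝ) • A.Ω D := by
      funext c
      exact Subsingleton.elim (α := E) _ _
    have h1 : A.Ω D = 0 := by rw [h0, zero_smul]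
    rw [h1]
    exact ContMDiff.of_le (contMDiff_zeroSection ℝ (T E M)) le_top
  intro c
  obtain ⟨x, hx0, hx⟩ := h.exists_ne_zero hdim hn htr c
  obtain ⟨Y, hY, rfl⟩ := Smooth.exists_eq x
  set X : VF E M := Y - ε • A.PP Y
  have hX : Smooth X := hY.sub ((hY.PP A).const_smul ε)
  have hPX (c : M) : A.P c (X c) = -(ε • X c) := h.P_sub (Y c)
  have hXc : X c = (2 : ℝ) • Y c := by
    change Y c - ε • A.P c (Y c) = _
    rw [hx, smul_neg, smul_smul, h.sq]
    module
  have hne : A.gg X X c ≠ 0 := (A.g.pos c _ (by rw [hXc]; simpa using hx0)).ne'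
  set V : VF E M := nabla D X (A.PP X) - A.PP (nabla D X X)
  have hV : Smooth V := (hX.nabla hD' (hX.PP A)).sub ((hX.nabla hD' hX).PP A)
  have hVΩ (c : M) : V c = (1 / (n : ℝ) * A.gg X X c) • A.Ω D c := by
    change V c = (1 / (n : ℝ) * A.g.inner c (X c) (X c)) • A.Ω D c
    rw [← h.covP_self hD (hPX c), A.covP_apply D hX]
    rfl
  have hf : ContMDiffAt 𝓘(ℝ, E) 𝓘(ℝ, ℝ) ∞ (fun c => (n : ℝ) * (A.gg X X c)⁻¹) c :=
    contMDiffAt_const.mul ((hX.gg A hX c).inv₀ hne)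
  refine (hf.smul_section (hV c)).congr_of_eventuallyEq ?_
  filter_upwards [(hX.gg A hX).continuous.continuousAt.eventually_ne hne] with c' hc'
  change (⟨c', A.Ω D c'⟩ : TotalSpace E (T E M)) = ⟨c', ((n : ℝ) * (A.gg X X c')⁻¹) • V c'⟩
  rw [hVΩ, smul_smul]
  have : (n : ℝ) * (A.gg X X c')⁻¹ * (1 / (n : ℝ) * A.gg X X c') = 1 := by
    field_simp
  rw [this, one_smul]

end IsWε

end AlmostProduct

/-! ### Natural connections with vectorial torsion -/

namespace AlmostProduct

variable (A : AlmostProduct E M)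

theorem gg_add_left (X X' Y : VF E M) : A.gg (X + X') Y = A.gg X Y + A.gg X' Y := by
  funext c
  simp [gg]

theorem gg_add_right (X Y Y' : VF E M) : A.gg X (Y + Y') = A.gg X Y + A.gg X Y' := by
  funext c
  simp [gg]

theorem gg_sub_left (X X' Y : VF E M) : A.gg (X - X') Y = A.gg X Y - A.gg X' Y := by
  funext c
  simp [gg]

theorem gg_smul_left (f : M → ℝ) (X Y : VF E M) : A.gg (f • X) Y = f * A.gg X Y := by
  funext c
  simp [gg]

theorem gg_smul_right (f : M → ℝ) (X Y : VF E M) : A.gg X (f • Y) = f * A.gg X Y := by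
  funext c
  simp [gg]

/-- The endomorphism `a + bP` of the tangent bundle, acting on tangent vectors. -/
def lin (a b : ℝ) {c : M} (x : T E M c) : T E M c := a • x + b • A.P c x

/-- The endomorphism `a + bP` of the tangent bundle, acting on vector fields. -/
def linF (a b : ℝ) (X : VF E M) : VF E M := a • X + b • A.PP X

theorem linF_apply (a b : ℝ) (X : VF E M) (c : M) : A.linF a b X c = A.lin a b (X c) := rfl

theorem _root_.RAP.Smooth.linF {X : VF E M} (hX : Smooth X) (a b : ℝ) : Smooth (A.linF a b X) :=
  (hX.const_smul a).add ((hX.PP A).const_smul b)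

variable (U : VF E M) (a b : ℝ)

/-- The skew endomorphism `Q_x z = g(Lx, z) U - g(U, z) Lx`, where `L = a + bP`. -/
def Q {c : M} (x z : T E M c) : T E M c :=
  A.g.inner c (A.lin a b x) z • U c - A.g.inner c (U c) z • A.lin a b x

/-- The operator `Q` on vector fields. -/
def QF (X Z : VF E M) : VF E M :=
  A.gg (A.linF a b X) Z • U - A.gg U Z • A.linF a b X

theorem QF_apply (X Z : VF E M) (c : M) : A.QF U a b X Z c = A.Q U a b (X c) (Z c) := rfl

theorem smooth_QF {U : VF E M} (hU : Smooth U) {X Z : VF E M} (hX : Smooth X) (hZ : Smooth Z) :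
    Smooth (A.QF U a b X Z) :=
  (hU.smul ((hX.linF A a b).gg A hZ)).sub ((hX.linF A a b).smul (hU.gg A hZ))

/-- The torsion `T(x, y) = g(U, x) Ly - g(U, y) Lx`, where `L = a + bP`. -/
def tors {c : M} (x y : T E M c) : T E M c :=
  A.g.inner c (U c) x • A.lin a b y - A.g.inner c (U c) y • A.lin a b x

/-- The difference at a point of the curvature operators of `∇' - Q` and `∇'`, where `∇'` is a
natural connection with torsion `T`; the vectors `u` and `v` stand for `∇'_x U` and `∇'_y U`. -/
def curvDiff {c : M} (u v x y z : T E M c) : T E M c :=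
  A.g.inner c (A.lin a b x) z • v - A.g.inner c v z • A.lin a b x
    - (A.g.inner c (A.lin a b y) z • u - A.g.inner c u z • A.lin a b y)
    - A.Q U a b (A.tors U a b x y) z
    + A.Q U a b x (A.Q U a b y z) - A.Q U a b y (A.Q U a b x z)

/-- `D` is the Levi-Civita connection of `g`, and `D'` is a natural connection with torsion
`T(x, y) = g(U, x) Ly - g(U, y) Lx`, where `L = a + bP` and `U` is a smooth field with
`PU = εU`, `ε² = 1`. -/
structure HasVectorialTorsion (D D' : Connection E M) (U : VF E M) (a b ε : ℝ) : Prop where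
  leviCivita : A.IsLeviCivita D
  natural : A.IsNatural D'
  smooth : Smooth U
  sq : ε * ε = 1
  P_U (c : M) : A.P c (U c) = ε • U c
  torsion (c : M) (x y : T E M c) : D'.torsion c x y = A.tors U a b x y

variable {A U a b}

theorem IsLeviCivita.nabla_sub_nabla {D : Connection E M} (h : A.IsLeviCivita D) {X Y : VF E M}
    (hX : Smooth X) (hY : Smooth Y) :
    nabla D X Y - nabla D Y X = VectorField.mlieBracket 𝓘(ℝ, E) X Y := by
  funext c
  have h₁ := torsion_apply D hX hY c
  rw [h.2.2] at h₁
  exact (sub_eq_zero.1 h₁.symm)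

/-- The first Bianchi identity of a torsion free connection. -/
theorem IsLeviCivita.bianchi {D : Connection E M} (h : A.IsLeviCivita D) {X Y Z : VF E M}
    (hX : Smooth X) (hY : Smooth Y) (hZ : Smooth Z) :
    curv D X Y Z + curv D Y Z X + curv D Z X Y = 0 := by
  have key {X Y Z : VF E M} (hX : Smooth X) (hY : Smooth Y) (hZ : Smooth Z) :
      nabla D X (nabla D Y Z) - nabla D X (nabla D Z Y)
        - nabla D (VectorField.mlieBracket 𝓘(ℝ, E) Y Z) X
        = VectorField.mlieBracket 𝓘(ℝ, E) X (VectorField.mlieBracket 𝓘(ℝ, E) Y Z) := by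
    rw [← nabla_sub D (hY.nabla h.1 hZ) (hZ.nabla h.1 hY), h.nabla_sub_nabla hY hZ,
      h.nabla_sub_nabla hX (hY.bracket hZ)]
  have h₁ := key hX hY hZ
  have h₂ := key hY hZ hX
  have h₃ := key hZ hX hY
  have hj := jacobi hX hY hZ
  have e₁ : VectorField.mlieBracket 𝓘(ℝ, E) (VectorField.mlieBracket 𝓘(ℝ, E) X Y) Z
      = -VectorField.mlieBracket 𝓘(ℝ, E) Z (VectorField.mlieBracket 𝓘(ℝ, E) X Y) :=
    VectorField.mlieBracket_swap
  have e₂ : VectorField.mlieBracket 𝓘(ℝ, E) Y (VectorField.mlieBracket 𝓘(ℝ, E) X Z)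
      = -VectorField.mlieBracket 𝓘(ℝ, E) Y (VectorField.mlieBracket 𝓘(ℝ, E) Z X) := by
    have hs : VectorField.mlieBracket 𝓘(ℝ, E) X Z
        = (-1 : ℝ) • VectorField.mlieBracket 𝓘(ℝ, E) Z X := by
      rw [VectorField.mlieBracket_swap, neg_one_smul]
    rw [hs]
    funext c
    rw [VectorField.mlieBracket_const_smul_right ((hZ.bracket hX).mdifferentiableAt c)]
    simp
  rw [e₁, e₂, ← h₁, ← h₂, ← h₃] at hj
  simp only [curv]
  rw [← sub_eq_zero] at hj
  rw [← hj]
  abel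

/-- The curvature operator of a metric connection is skew: apply `[X, Y] = XY - YX` to
`g(Z, W)`. -/
theorem IsMetric.gg_curv [T2Space M] {D : Connection E M} (h : A.IsMetric D)
    (hs : D.ContMDiffCovariantDerivative ∞) {X Y Z W : VF E M}
    (hX : Smooth X) (hY : Smooth Y) (hZ : Smooth Z) (hW : Smooth W) :
    A.gg (curv D X Y Z) W = -A.gg (curv D X Y W) Z := by
  have key {X Y : VF E M} (hX : Smooth X) (hY : Smooth Y) : lieD X (lieD Y (A.gg Z W))
      = A.gg (nabla D X (nabla D Y Z)) W + A.gg (nabla D Y Z) (nabla D X W)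
        + (A.gg (nabla D X Z) (nabla D Y W) + A.gg Z (nabla D X (nabla D Y W))) := by
    rw [h Y Z W hY hZ hW, lieD_add ((hY.nabla hs hZ).gg A hW) (hZ.gg A (hY.nabla hs hW)),
      h X _ W hX (hY.nabla hs hZ) hW, h X Z _ hX hZ (hY.nabla hs hW)]
  have hsm {X : VF E M} (hX : Smooth X) :
      ContMDiff 𝓘(ℝ, E) 𝓘(ℝ, ℝ) ∞ (lieD X (A.gg Z W)) := by
    rw [h X Z W hX hZ hW]
    exact ((hX.nabla hs hZ).gg A hW).add (hZ.gg A (hX.nabla hs hW))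
  have h₁ := lieD_mlieBracket hX hY (hZ.gg A hW) (hsm hX) (hsm hY)
  rw [key hX hY, key hY hX, h _ Z W (hX.bracket hY) hZ hW] at h₁
  rw [A.gg_comm (curv D X Y W) Z, A.gg_comm Z (curv D X Y W), ← sub_eq_zero]
  simp only [curv, gg_sub_left, A.gg_comm Z] at h₁ ⊢
  rw [← sub_eq_zero] at h₁
  rw [← neg_eq_zero, ← h₁]
  ring

/-- A natural connection commutes with `P`. -/
theorem IsNatural.nabla_PP {D : Connection E M} (h : A.IsNatural D) (X : VF E M) {Y : VF E M}
    (hY : Smooth Y) : nabla D X (A.PP Y) = A.PP (nabla D X Y) := by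
  funext c
  have h₁ := A.covP_apply D hY c (X c)
  rw [h.2.2] at h₁
  exact sub_eq_zero.1 h₁.symm

theorem IsNatural.curv_PP {D : Connection E M} (h : A.IsNatural D) {X Y Z : VF E M}
    (hX : Smooth X) (hY : Smooth Y) (hZ : Smooth Z) :
    curv D X Y (A.PP Z) = A.PP (curv D X Y Z) := by
  rw [curv, h.nabla_PP _ hZ, h.nabla_PP _ hZ, h.nabla_PP _ hZ, h.nabla_PP _ (hY.nabla h.1 hZ),
    h.nabla_PP _ (hX.nabla h.1 hZ)]
  funext c
  simp [curv, PP]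

theorem IsNatural.nabla_linF {D : Connection E M} (h : A.IsNatural D) (a b : ℝ) (X : VF E M)
    {Y : VF E M} (hY : Smooth Y) : nabla D X (A.linF a b Y) = A.linF a b (nabla D X Y) := by
  rw [linF, nabla_add D (hY.const_smul a) ((hY.PP A).const_smul b), nabla_const_smul D hY,
    nabla_const_smul D (hY.PP A), h.nabla_PP _ hY, linF]

/-- The Leibniz rule for `Q`, in which only `U` is not parallel. -/
theorem IsNatural.nabla_QF {D : Connection E M} (h : A.IsNatural D) (hU : Smooth U) {X Y Z : VF E M}
    (hX : Smooth X) (hY : Smooth Y) (hZ : Smooth Z) :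
    nabla D X (A.QF U a b Y Z) = A.QF U a b (nabla D X Y) Z + A.QF U a b Y (nabla D X Z)
      + (A.gg (A.linF a b Y) Z • nabla D X U - A.gg (nabla D X U) Z • A.linF a b Y) := by
  have hL := hY.linF A a b
  rw [QF, nabla_sub D (hU.smul (hL.gg A hZ)) (hL.smul (hU.gg A hZ)),
    nabla_smul D (hL.gg A hZ) hU, nabla_smul D (hU.gg A hZ) hL, h.2.1 X _ Z hX hL hZ,
    h.2.1 X U Z hX hU hZ, h.nabla_linF a b X hY]
  simp only [QF]
  module

namespace HasVectorialTorsion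

variable {D D' : Connection E M} {ε : ℝ}

/-- The Levi-Civita connection is `∇' - Q`, by the Koszul argument. -/
theorem nabla_eq [T2Space M] (h : A.HasVectorialTorsion D D' U a b ε) {X Y : VF E M}
    (hX : Smooth X) (hY : Smooth Y) : nabla D X Y = nabla D' X Y - A.QF U a b X Y := by
  -- For `B(X, Y, Z) = g(∇'_X Y - ∇_X Y, Z)`, metricity makes `B` skew in the last two arguments,
  -- and the torsion is `B(X, Y, Z) - B(Y, X, Z)`; the two facts determine `B`.
  have skew {X Y Z : VF E M} (hX : Smooth X) (hY : Smooth Y) (hZ : Smooth Z) (c : M) :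
      A.g.inner c (nabla D' X Y c) (Z c) - A.g.inner c (nabla D X Y c) (Z c)
        + (A.g.inner c (nabla D' X Z c) (Y c) - A.g.inner c (nabla D X Z c) (Y c)) = 0 := by
    have h₁ := congrFun (h.leviCivita.2.1 X Y Z hX hY hZ) c
    rw [h.natural.2.1 X Y Z hX hY hZ, A.gg_comm Y, A.gg_comm Y] at h₁
    simp only [Pi.add_apply, gg] at h₁
    linarith
  have tor {X Y Z : VF E M} (hX : Smooth X) (hY : Smooth Y) (c : M) :
      A.g.inner c (nabla D' X Y c) (Z c) - A.g.inner c (nabla D X Y c) (Z c)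
        - (A.g.inner c (nabla D' Y X c) (Z c) - A.g.inner c (nabla D Y X c) (Z c))
        = A.g.inner c (A.tors U a b (X c) (Y c)) (Z c) := by
    have h₁ := torsion_apply D' hX hY c
    rw [h.torsion, ← h.leviCivita.nabla_sub_nabla hX hY] at h₁
    rw [h₁]
    simp only [Pi.sub_apply, map_sub, sub_apply]
    ring
  funext c
  refine A.eq_of_inner_eq fun z => ?_
  obtain ⟨Z, hZ, rfl⟩ := Smooth.exists_eq z
  have s₁ := skew hX hY hZ c
  have s₂ := skew hY hZ hX c
  have s₃ := skew hZ hX hY c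
  have t₁ := tor (Z := Z) hX hY c
  have t₂ := tor (Z := X) hY hZ c
  have t₃ := tor (Z := Y) hZ hX c
  simp only [Pi.sub_apply, QF_apply, Q, tors, lin, map_sub, map_add, map_smul, sub_apply,
    add_apply, smul_apply, smul_eq_mul, A.inner_P_left] at t₁ t₂ t₃ ⊢
  have e₁ := A.g.symm c (X c) (Y c)
  have e₂ := A.g.symm c (X c) (Z c)
  have e₃ := A.g.symm c (Y c) (Z c)
  have e₄ : A.g.inner c (X c) (A.P c (Y c)) = A.g.inner c (Y c) (A.P c (X c)) := by
    rw [← A.inner_P_left, A.g.symm]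
  have e₅ : A.g.inner c (X c) (A.P c (Z c)) = A.g.inner c (Z c) (A.P c (X c)) := by
    rw [← A.inner_P_left, A.g.symm]
  have e₆ : A.g.inner c (Y c) (A.P c (Z c)) = A.g.inner c (Z c) (A.P c (Y c)) := by
    rw [← A.inner_P_left, A.g.symm]
  simp only [e₁, e₂, e₃, e₄, e₅, e₆] at t₁ t₂ t₃ ⊢
  linarith

/-- The curvature operators of `∇ = ∇' - Q` and `∇'` differ by an algebraic expression in `U` and
its first derivative. -/
theorem curv_eq [T2Space M] (h : A.HasVectorialTorsion D D' U a b ε) {X Y Z : VF E M}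
    (hX : Smooth X) (hY : Smooth Y) (hZ : Smooth Z) (c : M) :
    curv D X Y Z c = curv D' X Y Z c
      + A.curvDiff U a b (nabla D' X U c) (nabla D' Y U c) (X c) (Y c) (Z c) := by
  have hs := h.natural.1
  have key {X Y : VF E M} (hX : Smooth X) (hY : Smooth Y) : nabla D X (nabla D Y Z)
      = nabla D' X (nabla D' Y Z)
        - (A.QF U a b (nabla D' X Y) Z + A.QF U a b Y (nabla D' X Z)
          + (A.gg (A.linF a b Y) Z • nabla D' X U - A.gg (nabla D' X U) Z • A.linF a b Y))
        - (A.QF U a b X (nabla D' Y Z) - A.QF U a b X (A.QF U a b Y Z)) := by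
    have hQ := A.smooth_QF a b h.smooth hY hZ
    rw [h.nabla_eq hY hZ, h.nabla_eq hX ((hY.nabla hs hZ).sub hQ),
      nabla_sub D' (hY.nabla hs hZ) hQ, h.natural.nabla_QF h.smooth hX hY hZ]
    congr 1
    funext c
    simp only [QF_apply, Pi.sub_apply, Q, map_sub]
    module
  have hbr : A.Q U a b (VectorField.mlieBracket 𝓘(ℝ, E) X Y c) (Z c)
      = A.Q U a b (nabla D' X Y c) (Z c) - A.Q U a b (nabla D' Y X c) (Z c)
        - A.Q U a b (A.tors U a b (X c) (Y c)) (Z c) := by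
    have h₁ := torsion_apply D' hX hY c
    rw [h.torsion] at h₁
    rw [h₁]
    simp only [Q, lin, map_sub, map_add, map_smul, sub_apply, add_apply, smul_apply, smul_eq_mul]
    module
  rw [curv, key hX hY, key hY hX, h.nabla_eq (hX.bracket hY) hZ]
  simp only [curv, Pi.sub_apply, Pi.add_apply, QF_apply, Pi.smul_apply', gg, linF_apply, hbr,
    curvDiff]
  abel

/-- `∇'U` takes values in the same eigenspace as `U`. -/
theorem P_nabla (h : A.HasVectorialTorsion D D' U a b ε) (X : VF E M) (c : M) :
    A.P c (nabla D' X U c) = ε • nabla D' X U c := by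
  have h₁ := congrFun (h.natural.nabla_PP X h.smooth) c
  have h₂ : A.PP U = ε • U := funext h.P_U
  rw [h₂, nabla_const_smul D' h.smooth] at h₁
  exact h₁.symm

/-- The torsion takes values in the kernel of `g(U, ·)`. -/
theorem inner_tors (h : A.HasVectorialTorsion D D' U a b ε) {c : M} (x y : T E M c) :
    A.g.inner c (U c) (A.tors U a b x y) = 0 := by
  have h₁ (x : T E M c) : A.g.inner c (U c) (A.P c x) = ε * A.g.inner c (U c) x := by
    rw [← A.inner_P_left, h.P_U, map_smul, smul_apply, smul_eq_mul]
  simp only [tors, lin, map_sub, map_add, map_smul, smul_eq_mul, h₁]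
  ring

end HasVectorialTorsion

/-! ### Algebra of the curvature difference -/

section Pointwise

variable {ε : ℝ}

/-- When `∇'θ` is symmetric, the curvature difference satisfies the first Bianchi identity. -/
theorem curvDiff_cyclic {c : M} {u v w x y z : T E M c}
    (hU : A.P c (U c) = ε • U c) (huy : A.g.inner c u y = A.g.inner c v x)
    (huz : A.g.inner c u z = A.g.inner c w x) (hvz : A.g.inner c v z = A.g.inner c w y) :
    A.curvDiff U a b u v x y z + A.curvDiff U a b v w y z x
      + A.curvDiff U a b w u z x y = 0 := by
  refine A.eq_of_inner_eq fun t => ?_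
  have hUP (x : T E M c) : A.g.inner c (U c) (A.P c x) = ε * A.g.inner c (U c) x := by
    rw [← A.inner_P_left, hU, map_smul, smul_apply, smul_eq_mul]
  have sU (x : T E M c) : A.g.inner c x (U c) = A.g.inner c (U c) x := A.g.symm c _ _
  have e₁ := A.g.symm c x y
  have e₂ := A.g.symm c x z
  have e₃ := A.g.symm c y z
  have eP (x y : T E M c) : A.g.inner c x (A.P c y) = A.g.inner c y (A.P c x) := by
    rw [← A.inner_P_left, A.g.symm]
  have e₄ := eP x y
  have e₅ := eP x z
  have e₆ := eP y z
  simp only [curvDiff, Q, tors, lin, map_sub, map_add, map_smul, sub_apply, add_apply, smul_apply,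
    smul_eq_mul, A.inner_P_left, A.P_P, hUP, huy, huz, hvz, e₁, e₂, e₃, e₄, e₅, e₆, map_zero,
    zero_apply, sU x, sU y, sU z, hU]
  ring

set_option maxHeartbeats 1000000 in
/-- The average of the curvature difference over `P` is `-(ψ₁ + ψ₂)(S)`, with `S` the form below.
Since `(a + bP)(1 + εP) = (a + εb)(1 + εP)`, averaging turns each term in which `U` or its
derivative is paired with the last vector into a multiple of `g(1 + εP ·, ·)`, and the quadratic terms of
this kind cancel. -/
theorem curvDiff_average (hε : ε * ε = 1) {c : M} {u v x y : T E M c}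
    (hU : A.P c (U c) = ε • U c) (hu : A.P c u = ε • u) (hv : A.P c v = ε • v)
    (z w : T E M c) {S : T E M c → T E M c → ℝ}
    (hSx : ∀ w, S x w = (a + ε * b) / 2 * A.g.inner c u w
      + (a * a + b * b) / 4 * A.g.inner c (U c) (U c) * A.g.inner c x w
      + a * b / 2 * A.g.inner c (U c) (U c) * A.g.inner c x (A.P c w))
    (hSy : ∀ w, S y w = (a + ε * b) / 2 * A.g.inner c v w
      + (a * a + b * b) / 4 * A.g.inner c (U c) (U c) * A.g.inner c y w
      + a * b / 2 * A.g.inner c (U c) (U c) * A.g.inner c y (A.P c w)) :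
    1 / 2 * (A.g.inner c (A.curvDiff U a b u v x y z) w
        + A.g.inner c (A.curvDiff U a b u v x y (A.P c z)) (A.P c w))
      = -((A.g.inner c y z * S x w - A.g.inner c x z * S y w
            + S y z * A.g.inner c x w - S x z * A.g.inner c y w)
          + (A.g.inner c y (A.P c z) * S x (A.P c w) - A.g.inner c x (A.P c z) * S y (A.P c w)
            + S y (A.P c z) * A.g.inner c x (A.P c w)
            - S x (A.P c z) * A.g.inner c y (A.P c w))) := by
  have hP {u : T E M c} (hu : A.P c u = ε • u) (x : T E M c) :
      A.g.inner c u (A.P c x) = ε * A.g.inner c u x := by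
    rw [← A.inner_P_left, hu, map_smul, smul_apply, smul_eq_mul]
  have sU (x : T E M c) : A.g.inner c x (U c) = A.g.inner c (U c) x := A.g.symm c _ _
  have e₁ := A.g.symm c x y
  have e₄ : A.g.inner c x (A.P c y) = A.g.inner c y (A.P c x) := by
    rw [← A.inner_P_left, A.g.symm]
  simp only [curvDiff, Q, tors, lin, hSx, hSy, map_sub, map_add, map_smul, sub_apply, add_apply,
    smul_apply, smul_eq_mul, A.inner_P_left, A.P_P, hP hU, hP hu, hP hv, e₁, e₄, sU x, sU y, hU]
  generalize A.g.inner c (U c) (U c) = UU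
  generalize A.g.inner c (U c) x = Ux
  generalize A.g.inner c (U c) y = Uy
  generalize A.g.inner c (U c) z = Uz
  generalize A.g.inner c (U c) w = Uw
  generalize A.g.inner c u z = uz
  generalize A.g.inner c u w = uw
  generalize A.g.inner c v z = vz
  generalize A.g.inner c v w = vw
  generalize A.g.inner c x z = xz
  generalize A.g.inner c x w = xw
  generalize A.g.inner c y z = yz
  generalize A.g.inner c y w = yw
  generalize A.g.inner c x (A.P c z) = xPz
  generalize A.g.inner c x (A.P c w) = xPw
  generalize A.g.inner c y (A.P c z) = yPz
  generalize A.g.inner c y (A.P c w) = yPw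
  -- The identity holds modulo `ε² = 1`; for `ε = ±1` it is polynomial in the remaining unknowns.
  have hcases : ε = 1 ∨ ε = -1 := by
    have : (ε - 1) * (ε + 1) = 0 := by linear_combination hε
    rcases mul_eq_zero.1 this with h | h
    · exact Or.inl (by linarith)
    · exact Or.inr (by linarith)
  rcases hcases with rfl | rfl <;> ring

end Pointwise

end AlmostProduct

/-! ### Curvature as a tensor -/

theorem curv_swap (D : Connection E M) (X Y Z : VF E M) : curv D X Y Z = -curv D Y X Z := by
  have h : VectorField.mlieBracket 𝓘(ℝ, E) X Y
      = (0 : VF E M) - VectorField.mlieBracket 𝓘(ℝ, E) Y X := by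
    rw [VectorField.mlieBracket_swap, zero_sub]
  have h0 : nabla D 0 Z = 0 := by
    funext c
    simp [nabla]
  simp only [curv]
  rw [h, nabla_sub_left, h0]
  abel

theorem curv_add_left {D : Connection E M} (hD : D.ContMDiffCovariantDerivative ∞)
    {X X' Y Z : VF E M} (hX : Smooth X) (hX' : Smooth X') (hZ : Smooth Z) :
    curv D (X + X') Y Z = curv D X Y Z + curv D X' Y Z := by
  simp only [curv]
  rw [nabla_add_left, nabla_add_left, mlieBracket_add_left hX hX', nabla_add_left,
    nabla_add D (hX.nabla hD hZ) (hX'.nabla hD hZ)]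
  abel

theorem curv_smul_left {D : Connection E M} (hD : D.ContMDiffCovariantDerivative ∞) {f : M → ℝ}
    (hf : ContMDiff 𝓘(ℝ, E) 𝓘(ℝ, ℝ) ∞ f) {X Y Z : VF E M} (hX : Smooth X) (hZ : Smooth Z) :
    curv D (f • X) Y Z = f • curv D X Y Z := by
  simp only [curv]
  rw [nabla_smul_left, nabla_smul_left, mlieBracket_smul_left hf hX, nabla_sub_left,
    nabla_smul_left, nabla_smul_left, nabla_smul D hf (hX.nabla hD hZ)]
  simp only [smul_sub]
  abel

namespace IsOneForm

theorem congr {φ ψ : VF E M → M → ℝ} (hψ : IsOneForm ψ) (h : ∀ X, Smooth X → φ X = ψ X) :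
    IsOneForm φ where
  smooth X hX := by
    rw [h X hX]
    exact hψ.smooth X hX
  add X X' hX hX' := by
    rw [h X hX, h X' hX', h _ (hX.add hX'), hψ.add X X' hX hX']
  smul f X hf hX := by
    rw [h X hX, h _ (hX.smul hf), hψ.smul f X hf hX]

theorem neg {φ : VF E M → M → ℝ} (hφ : IsOneForm φ) : IsOneForm (fun X => -φ X) where
  smooth X hX := (hφ.smooth X hX).neg
  add X X' hX hX' := by rw [hφ.add X X' hX hX', neg_add]
  smul f X hf hX := by rw [hφ.smul f X hf hX, mul_neg]

theorem gg (A : AlmostProduct E M) {V : VF E M} (hV : Smooth V) : IsOneForm (A.gg V) where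
  smooth _ hX := hV.gg A hX
  add X X' _ _ := A.gg_add_right V X X'
  smul f X _ _ := A.gg_smul_right f V X

end IsOneForm

theorem IsTensor02.congr {B B' : VF E M → VF E M → M → ℝ} (hB : IsTensor02 B)
    (h : ∀ X Y, Smooth X → Smooth Y → B' X Y = B X Y) : IsTensor02 B' where
  fst Y hY := (hB.fst Y hY).congr fun X hX => h X Y hX hY
  snd X hX := (hB.snd X hX).congr fun Y hY => h X Y hX hY

namespace AlmostProduct

variable {A : AlmostProduct E M}

theorem IsMetric.isTensor04 [T2Space M] {D : Connection E M} (h : A.IsMetric D)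
    (hs : D.ContMDiffCovariantDerivative ∞) : IsTensor04 (A.R4 D) := by
  have hfst (Y Z W : VF E M) (hY : Smooth Y) (hZ : Smooth Z) (hW : Smooth W) :
      IsOneForm (fun X => A.R4 D X Y Z W) :=
    { smooth := fun X hX => (hX.curv hs hY hZ).gg A hW
      add := fun X X' hX hX' => by
        simp only [R4, curv_add_left hs hX hX' hZ, gg_add_left]
      smul := fun f X hf hX => by
        simp only [R4, curv_smul_left hs hf hX hZ, gg_smul_left] }
  have hfth (X Y Z : VF E M) (hX : Smooth X) (hY : Smooth Y) (hZ : Smooth Z) :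
      IsOneForm (fun W => A.R4 D X Y Z W) := IsOneForm.gg A (hX.curv hs hY hZ)
  refine ⟨hfst, fun X Z W hX hZ hW => ?_, fun X Y W hX hY hW => ?_, hfth⟩
  · refine (hfst X Z W hX hZ hW).neg.congr fun Y _ => ?_
    rw [R4, curv_swap]
    funext c
    simp [R4, AlmostProduct.gg]
  · exact (hfth X Y W hX hY hW).neg.congr fun Z hZ => h.gg_curv hs hX hY hZ hW

namespace HasVectorialTorsion

variable {D D' : Connection E M} {U : VF E M} {a b ε : ℝ}

/-- The endomorphism metrically equivalent to the form
`(a + εb)/2 ∇'θ + g(U, U) ((a² + b²)/4 g + ab/2 g̃)`. For `U = Ω` and the parameters of the family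
this form is `S`. -/
def endS (A : AlmostProduct E M) (D' : Connection E M) (U : VF E M) (a b ε : ℝ) (X : VF E M) :
    VF E M :=
  ((a + ε * b) / 2) • nabla D' X U
    + (((a * a + b * b) / 4) • (A.gg U U • X) + (a * b / 2) • (A.gg U U • A.PP X))

theorem gg_endS (X Y : VF E M) (c : M) : A.gg (endS A D' U a b ε X) Y c
    = (a + ε * b) / 2 * A.g.inner c (nabla D' X U c) (Y c)
      + (a * a + b * b) / 4 * A.g.inner c (U c) (U c) * A.g.inner c (X c) (Y c)
      + a * b / 2 * A.g.inner c (U c) (U c) * A.g.inner c (X c) (A.P c (Y c)) := by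
  simp only [gg, endS, PP, Pi.add_apply, Pi.smul_apply, Pi.smul_apply', map_add, map_smul,
    add_apply, smul_apply, smul_eq_mul, A.inner_P_left]
  ring

theorem isTensor02 (h : A.HasVectorialTorsion D D' U a b ε) :
    IsTensor02 (fun X Y => A.gg (endS A D' U a b ε X) Y) := by
  have hU := h.smooth
  have hs {X : VF E M} (hX : Smooth X) : Smooth (endS A D' U a b ε X) :=
    ((hX.nabla h.natural.1 hU).const_smul _).add
      (((hX.smul (hU.gg A hU)).const_smul _).add
        (((hX.PP A).smul (hU.gg A hU)).const_smul _))
  refine ⟨fun Y hY => ⟨fun X hX => (hs hX).gg A hY, fun X X' _ _ => ?_, fun f X _ _ => ?_⟩,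
    fun X hX => IsOneForm.gg A (hs hX)⟩
  · funext c
    simp only [gg_endS, nabla_add_left, Pi.add_apply, map_add, add_apply]
    ring
  · funext c
    simp only [gg_endS, nabla_smul_left, Pi.smul_apply', Pi.mul_apply, map_smul, smul_apply,
      smul_eq_mul]
    ring

/-- The Bianchi identity passes from the Levi-Civita connection to `D'`, because the difference of
the two curvatures has cyclic sum zero when `g(D'_X U, Y)` is symmetric. -/
theorem bianchi [T2Space M] (h : A.HasVectorialTorsion D D' U a b ε)
    (hN : ∀ X Y : VF E M, Smooth X → Smooth Y →
      A.gg (nabla D' X U) Y = A.gg (nabla D' Y U) X)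
    {X Y Z : VF E M} (hX : Smooth X) (hY : Smooth Y) (hZ : Smooth Z) :
    curv D' X Y Z + curv D' Y Z X + curv D' Z X Y = 0 := by
  funext c
  have h₁ := congrFun (h.leviCivita.bianchi hX hY hZ) c
  have h₂ := curvDiff_cyclic (a := a) (b := b) (h.P_U c) (congrFun (hN X Y hX hY) c)
    (congrFun (hN X Z hX hZ) c) (congrFun (hN Y Z hY hZ) c)
  simp only [Pi.add_apply, h.curv_eq hX hY hZ, h.curv_eq hY hZ hX, h.curv_eq hZ hX hY] at h₁ ⊢
  rw [Pi.zero_apply] at h₁ ⊢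
  rw [← h₁, ← sub_eq_zero, ← neg_eq_zero, ← h₂]
  abel

theorem isPTensor [T2Space M] (h : A.HasVectorialTorsion D D' U a b ε)
    (hN : ∀ X Y : VF E M, Smooth X → Smooth Y →
      A.gg (nabla D' X U) Y = A.gg (nabla D' Y U) X) : A.IsPTensor (A.R4 D') where
  curvatureLike :=
    { tensor := IsMetric.isTensor04 h.natural.2.1 h.natural.1
      skew_fst := fun X Y Z W _ _ _ _ => by
        rw [R4, curv_swap]
        funext c
        simp [R4, gg]
      skew_snd := fun X Y Z W hX hY hZ hW => h.natural.2.1.gg_curv h.natural.1 hX hY hZ hW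
      bianchi := fun X Y Z W hX hY hZ _ => by
        simp only [R4]
        rw [← gg_add_left, ← gg_add_left, h.bianchi hN hX hY hZ]
        funext c
        simp [gg] }
  invariant X Y Z W hX hY hZ _ := by
    rw [R4, h.natural.curv_PP hX hY hZ, gg_PP_left, PP_PP, R4]

theorem K_eq [T2Space M] (h : A.HasVectorialTorsion D D' U a b ε)
    {S : VF E M → VF E M → M → ℝ}
    (hS : ∀ X Y : VF E M, Smooth X → Smooth Y → S X Y = A.gg (endS A D' U a b ε X) Y)
    {X Y Z W : VF E M} (hX : Smooth X) (hY : Smooth Y) (hZ : Smooth Z) (hW : Smooth W) :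
    A.K D X Y Z W = A.R4 D' X Y Z W - (A.ψ₁ S X Y Z W + A.ψ₂ S X Y Z W) := by
  funext c
  have hPZ := hZ.PP A
  have hPW := hW.PP A
  have h₁ := curvDiff_average h.sq (h.P_U c) (h.P_nabla X c) (h.P_nabla Y c) (Z c) (W c)
    (a := a) (b := b) (x := X c) (y := Y c)
    (S := fun x w => (a + ε * b) / 2 * A.g.inner c (D' U c x) w
      + (a * a + b * b) / 4 * A.g.inner c (U c) (U c) * A.g.inner c x w
      + a * b / 2 * A.g.inner c (U c) (U c) * A.g.inner c x (A.P c w))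
    (fun _ => rfl) (fun _ => rfl)
  have h₂ := congrFun (h.natural.curv_PP hX hY hZ) c
  simp only [K, R4, ψ₁, ψ₂, Pi.sub_apply, Pi.add_apply, Pi.mul_apply]
  rw [hS X W hX hW, hS Y W hY hW, hS X _ hX hPW, hS Y _ hY hPW, hS Y Z hY hZ,
    hS X Z hX hZ, hS Y _ hY hPZ, hS X _ hX hPZ]
  simp only [gg_endS]
  have h₃ : A.gg (curv D X Y Z) W c = A.g.inner c (curv D' X Y Z c) (W c)
      + A.g.inner c (A.curvDiff U a b (nabla D' X U c) (nabla D' Y U c) (X c) (Y c) (Z c))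
        (W c) := by
    rw [gg, h.curv_eq hX hY hZ, map_add, add_apply]
  have h₄ : A.gg (curv D X Y (A.PP Z)) (A.PP W) c = A.g.inner c (curv D' X Y Z c) (W c)
      + A.g.inner c (A.curvDiff U a b (nabla D' X U c) (nabla D' Y U c) (X c) (Y c)
        (A.P c (Z c))) (A.P c (W c)) := by
    rw [gg, h.curv_eq hX hY hPZ, h₂, map_add, add_apply]
    simp only [PP, A.g_P_P]
  rw [h₃, h₄]
  simp only [gg, PP, nabla] at h₁ ⊢
  linear_combination h₁

end HasVectorialTorsion

/-! ### The two-parametric family -/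

/-- As `θ ∘ P = εθ`, the two-parametric torsion has the vectorial form with
`a = λ + εμ + ε/(2n)` and `b = ελ + μ`. -/
theorem HasTorsion.hasVectorialTorsion [T2Space M] {D D' : Connection E M} {n : ℕ}
    {lam mu ε : ℝ} (hdim : Module.finrank ℝ E = 2 * n) (htr : A.TraceFree)
    (hD : A.IsLeviCivita D) (hW : A.IsWε D n ε) (hD' : A.IsNatural D')
    (hT : A.HasTorsion D D' n lam mu) :
    A.HasVectorialTorsion D D' (A.Ω D) (lam + ε * mu + ε * (1 / (2 * n : ℝ))) (ε * lam + mu) ε where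
  leviCivita := hD
  natural := hD'
  smooth := hW.smooth_Ω hdim htr hD.2.1 hD.1
  sq := hW.sq
  P_U := hW.P_Ω hD.2.1
  torsion c x y := by
    refine A.eq_of_inner_eq fun z => ?_
    rw [hT]
    simp only [tors, lin, inner_Ω, hW.θ_P hD.2.1, map_sub, map_add, map_smul, sub_apply,
      add_apply, smul_apply, smul_eq_mul, A.inner_P_left]
    ring

theorem θθ_eq (D : Connection E M) (X : VF E M) : A.θθ D X = A.gg (A.Ω D) X := by
  funext c
  exact (A.inner_Ω D (X c)).symm

theorem IsMetric.covθ_eq {D D' : Connection E M} (hΩ : Smooth (A.Ω D)) (hD' : A.IsMetric D')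
    {X Y : VF E M} (hX : Smooth X) (hY : Smooth Y) :
    A.covθ D D' X Y = A.gg (nabla D' X (A.Ω D)) Y := by
  rw [covθ, θθ_eq, θθ_eq, hD' X _ Y hX hΩ hY, add_sub_cancel_right]

/-- `∇'θ` is symmetric: its skew part is `dθ - θ(T(·, ·)) = 0`. -/
theorem IsClosedθ.symm {D D' : Connection E M} {a b ε : ℝ} (hθ : A.IsClosedθ D)
    (h : A.HasVectorialTorsion D D' (A.Ω D) a b ε) {X Y : VF E M}
    (hX : Smooth X) (hY : Smooth Y) :
    A.gg (nabla D' X (A.Ω D)) Y = A.gg (nabla D' Y (A.Ω D)) X := by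
  funext c
  have h₁ := congrFun (hθ X Y hX hY) c
  rw [θθ_eq, θθ_eq, θθ_eq, h.natural.2.1 X _ Y hX h.smooth hY,
    h.natural.2.1 Y _ X hY h.smooth hX] at h₁
  have h₂ := h.inner_tors (X c) (Y c)
  rw [← h.torsion, torsion_apply D' hX hY, map_sub, map_sub] at h₂
  simp only [Pi.sub_apply, Pi.add_apply, Pi.zero_apply, gg] at h₁ ⊢
  linarith

theorem S_eq [T2Space M] {D D' : Connection E M} {n : ℕ} {lam mu ε : ℝ}
    (h : A.HasVectorialTorsion D D' (A.Ω D) (lam + ε * mu + ε * (1 / (2 * n : ℝ)))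
      (ε * lam + mu) ε) {X Y : VF E M} (hX : Smooth X) (hY : Smooth Y) :
    A.S D D' n lam mu ε X Y = A.gg (HasVectorialTorsion.endS A D' (A.Ω D)
      (lam + ε * mu + ε * (1 / (2 * n : ℝ))) (ε * lam + mu) ε X) Y := by
  funext c
  rw [HasVectorialTorsion.gg_endS, S, IsMetric.covθ_eq h.smooth h.natural.2.1 hX hY]
  -- Since `PΩ = εΩ`, both `p` and `q` are multiples of `Ω`.
  have hp : A.p D n lam mu c = (lam + ε * mu + ε * (1 / (2 * n : ℝ))) • A.Ω D c := by
    change lam • A.Ω D c + (mu + 1 / (2 * n : ℝ)) • A.P c (A.Ω D c) = _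
    rw [h.P_U]
    module
  have hq : A.q D lam mu c = (ε * lam + mu) • A.Ω D c := by
    change lam • A.P c (A.Ω D c) + mu • A.Ω D c = _
    rw [h.P_U]
    module
  simp only [gg, gt, PP, hp, hq, map_smul, smul_apply, smul_eq_mul]
  linear_combination (-lam / 2) * A.g.inner c (nabla D' X (A.Ω D) c) (Y c) * h.sq

end AlmostProduct

end RAP

end

theorem theorem2p1
    {E : Type*} [NormedAddCommGroup E] [NormedSpace ℝ E] [FiniteDimensional ℝ E]
    {M : Type*} [TopologicalSpace M] [T2Space M] [ChartedSpace E M] [IsManifold 𝓘(ℝ, E) ∞ M]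
    (n : ℕ) (hdim : Module.finrank ℝ E = 2 * n)
    (A : RAP.AlmostProduct E M) (htr : A.TraceFree)
    (D : RAP.Connection E M) (hD : A.IsLeviCivita D)
    (ε : ℝ) (hW : (A.IsW3 D n ∧ ε = -1) ∨ (A.IsW6 D n ∧ ε = 1))
    (hθ : A.IsClosedθ D)
    (D' : RAP.Connection E M) (hD' : A.IsNatural D')
    (lam mu : ℝ) (hT : A.HasTorsion D D' n lam mu) :
    RAP.IsTensor02 (A.S D D' n lam mu ε) ∧
    (∀ Y Z : RAP.VF E M, RAP.Smooth Y → RAP.Smooth Z →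
      A.S D D' n lam mu ε Y Z = A.S D D' n lam mu ε Z Y) ∧
    (∀ X Y Z W : RAP.VF E M,
      RAP.Smooth X → RAP.Smooth Y → RAP.Smooth Z → RAP.Smooth W →
      A.K D X Y Z W = A.R4 D' X Y Z W
        - (A.ψ₁ (A.S D D' n lam mu ε) X Y Z W + A.ψ₂ (A.S D D' n lam mu ε) X Y Z W)) ∧
    A.IsPTensor (A.R4 D') := by
  have h := hT.hasVectorialTorsion hdim htr hD (A.isWε_of hW) hD'
  have hS (X Y : RAP.VF E M) (hX : RAP.Smooth X) (hY : RAP.Smooth Y) :=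
    RAP.AlmostProduct.S_eq h hX hY
  have hN (X Y : RAP.VF E M) (hX : RAP.Smooth X) (hY : RAP.Smooth Y) := hθ.symm h hX hY
  refine ⟨h.isTensor02.congr hS, fun Y Z hY hZ => ?_, fun X Y Z W hX hY hZ hW => ?_,
    h.isPTensor hN⟩
  · rw [hS Y Z hY hZ, hS Z Y hZ hY]
    funext c
    have h₁ := congrFun (hN Y Z hY hZ) c
    have h₂ := A.g.symm c (Y c) (Z c)
    have h₃ : A.g.inner c (Y c) (A.P c (Z c)) = A.g.inner c (Z c) (A.P c (Y c)) := by
      rw [← A.inner_P_left, A.g.symm]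
    simp only [RAP.AlmostProduct.gg] at h₁
    rw [RAP.AlmostProduct.HasVectorialTorsion.gg_endS,
      RAP.AlmostProduct.HasVectorialTorsion.gg_endS, h₁, h₂, h₃]
  · exact h.K_eq hS hX hY hZ hW
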